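/- Let $n, r \ge 0$ be integers. For a field $k$ let $\mathcal F_k$ be the set of $n$-step flags $0=V_0\subseteq V_1\subseteq\cdots\subseteq V_n=k^r$ (equalities allowed), and let $\Theta_r$ be the set of $n\times n$ matrices of non-negative integers whose entries sum to $r$. For $A=(a_{ij})\in\Theta_r$ let $\mathcal O_A\subseteq\mathcal F_k\times\mathcal F_k$ be the set of pairs $(V_\bullet,V'_\bullet)$ with $$a_{ij}=\dim\bigl(V_{i-1}+(V_i\cap V'_j)\bigr)-\dim\bigl(V_{i-1}+(V_i\cap V'_{j-1})\bigr)\quad\text{for all } i,j;$$ these sets are the $\mathrm{GL}_r(k)$-orbits. For $A,A',A''\in\Theta_r$ let $g_{A,A',A''}\in\mathbb Z[q]$ be the unique polynomial (it exists by a theorem of Beilinson, Lusztig and MacPherson) whose value at $q=|k|$, for every finite field $k$ and every $(f_1,f_2)\in\mathcal O_{A''}$, is the number of $f\in\mathcal F_k$ with $(f_1,f)\in\mathcal O_A$ and $(f,f_2)\in\mathcal O_{A'}$. The $q$-Schur algebra $S_q(n,r)$ is the free $\mathbb Z[q,q^{-1}]$-module with basis $\{e_A : A\in\Theta_r\}$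 and the bilinear multiplication $e_Ae_{A'}=\sum_{A''\in\Theta_r}g_{A,A',A''}e_{A''}$. For $1\le i\le n-1$ put $$E_i=\sum_D e_{E_{i,i+1}+D}\in S_q(n,r),$$ where $E_{i,i+1}$ is the elementary matrix and $D$ runs over the diagonal matrices of non-negative integers with entries summing to $r-1$ (so $E_i=0$ if $r=0$). Then $E_1,\dots,E_{n-1}$ satisfy the following modified quantum Serre relations, for all $i,j\in\{1,\dots,n-1\}$: $$E_i^2E_j-(q+1)E_iE_jE_i+q\,E_jE_i^2=0\quad\text{if } j=i+1,$$ $$E_jE_i^2-(q+1)E_iE_jE_i+q\,E_i^2E_j=0\quad\text{if } j=i-1,$$ $$E_iE_j-E_jE_i=0\quad\text{if } |i-j|>1.$$ Here the triple products do not depend on the bracketing: $(E_iE_j)E_k=E_i(E_jE_k)$ for all $i,j,k\in\{1,\dots,n-1\}$. -/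

import Mathlib

open scoped LaurentPolynomial Polynomial

noncomputable section

namespace QSchur

/-- An `n`-step flag `0 = V₀ ⊆ V₁ ⊆ ⋯ ⊆ Vₙ = V` in `V = K ^ r`; the inclusions may be equalities. -/
structure Flag (K : Type) [Field K] (n r : ℕ) where
  /-- The `i`-th step of the flag. -/
  step : Fin (n + 1) → Submodule K (Fin r → K)
  mono : Monotone step
  step_zero : step 0 = ⊥
  step_last : step (Fin.last n) = ⊤

/-- The relative position of two flags: the matrix with entries
`a i j = dim (V (i-1) + V i ∩ V' j) - dim (V (i-1) + V i ∩ V' (j-1))`. As `i j : Fin n` count from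
zero, the step `V i` of the formula is `step i.succ` and `V (i-1)` is `step i.castSucc`. The natural
subtraction never truncates, since `V' (j-1) ⊆ V' j`. -/
def relPos {K : Type} [Field K] {n r : ℕ} (f f' : Flag K n r) : Matrix (Fin n) (Fin n) ℕ :=
  Matrix.of fun i j =>
    Module.finrank K
        ↥(f.step i.castSucc ⊔ (f.step i.succ ⊓ f'.step j.succ)) -
      Module.finrank K
        ↥(f.step i.castSucc ⊔ (f.step i.succ ⊓ f'.step j.castSucc))

/-- The `n × n` matrices of non-negative integers whose entries sum to `r`. -/
def Theta (n r : ℕ) : Type :=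
  {A : Matrix (Fin n) (Fin n) ℕ // ∑ i, ∑ j, A i j = r}

instance (n r : ℕ) : Finite (Theta n r) := by
  have hle : ∀ (A : Theta n r) (i j : Fin n), A.1 i j < r + 1 := by
    intro A i j
    have h1 : A.1 i j ≤ ∑ j, A.1 i j :=
      Finset.single_le_sum (f := fun j => A.1 i j) (fun _ _ => Nat.zero_le _) (Finset.mem_univ j)
    have h2 : ∑ j, A.1 i j ≤ ∑ i, ∑ j, A.1 i j :=
      Finset.single_le_sum (f := fun i => ∑ j, A.1 i j) (fun _ _ => Nat.zero_le _)
        (Finset.mem_univ i)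
    have h3 := A.2
    omega
  refine Finite.of_injective
    (fun (A : Theta n r) (i j : Fin n) => (⟨A.1 i j, hle A i j⟩ : Fin (r + 1))) ?_
  intro A B h
  apply Subtype.ext
  ext i j
  exact congrArg Fin.val (congrFun (congrFun h i) j)

instance (n r : ℕ) : Fintype (Theta n r) := Fintype.ofFinite _

/-- The orbit `O_A` of pairs of flags in `K ^ r` that corresponds to the matrix `A`. -/
def orbit (K : Type) [Field K] {n r : ℕ} (A : Theta n r) : Set (Flag K n r × Flag K n r) :=
  {p | relPos p.1 p.2 = A.1}

/-- The integer polynomial `p` counts, over every finite field `K` and for every pair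
`(f₁, f₂) ∈ O_C`, the flags `f` with `(f₁, f) ∈ O_A` and `(f, f₂) ∈ O_B`. -/
def IsStructurePolynomial {n r : ℕ} (A B C : Theta n r) (p : ℤ[X]) : Prop :=
  ∀ (K : Type) [Field K] [Finite K] (f₁ f₂ : Flag K n r), (f₁, f₂) ∈ orbit K C →
    (({f : Flag K n r | (f₁, f) ∈ orbit K A ∧ (f, f₂) ∈ orbit K B}.ncard : ℕ) : ℤ) =
      p.eval (Nat.card K : ℤ)

open Classical in
/-- The structure polynomial `g_{A,B,C}`: the polynomial that counts as above. It is unique, because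
`O_C` is non-empty over every field and there are infinitely many finite fields; that it exists is a
theorem of Beilinson, Lusztig and MacPherson. -/
def structurePolynomial {n r : ℕ} (A B C : Theta n r) : ℤ[X] :=
  if h : ∃ p : ℤ[X], IsStructurePolynomial A B C p then h.choose else 0

end QSchur

/-- The `q`-Schur algebra `S_q(n, r)`: the free `ℤ[q, q⁻¹]`-module on the basis
`e_A`, `A ∈ Theta n r`. -/
def QSchurAlgebra (n r : ℕ) : Type := QSchur.Theta n r →₀ ℤ[T;T⁻¹]

namespace QSchur

instance (n r : ℕ) : AddCommGroup (QSchurAlgebra n r) :=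
  inferInstanceAs (AddCommGroup (Theta n r →₀ ℤ[T;T⁻¹]))

instance (n r : ℕ) : Module ℤ[T;T⁻¹] (QSchurAlgebra n r) :=
  inferInstanceAs (Module ℤ[T;T⁻¹] (Theta n r →₀ ℤ[T;T⁻¹]))

/-- The basis element `e_A`. -/
def e {n r : ℕ} (A : Theta n r) : QSchurAlgebra n r :=
  (Finsupp.single A 1 : Theta n r →₀ ℤ[T;T⁻¹])

/-- The `ℤ[q, q⁻¹]`-bilinear multiplication with `e_A e_B = ∑_C g_{A,B,C} e_C`. -/
def mulBilin (n r : ℕ) :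
    QSchurAlgebra n r →ₗ[ℤ[T;T⁻¹]] QSchurAlgebra n r →ₗ[ℤ[T;T⁻¹]] QSchurAlgebra n r :=
  Finsupp.linearCombination ℤ[T;T⁻¹] fun A : Theta n r =>
    (Finsupp.linearCombination ℤ[T;T⁻¹] fun B : Theta n r =>
      ∑ C : Theta n r, (structurePolynomial A B C).toLaurent • (e C : QSchurAlgebra n r) :
      QSchurAlgebra n r →ₗ[ℤ[T;T⁻¹]] QSchurAlgebra n r)

instance (n r : ℕ) : NonUnitalNonAssocRing (QSchurAlgebra n r) where
  mul x y := mulBilin n r x y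
  left_distrib x y z := (mulBilin n r x).map_add y z
  right_distrib x y z := by
    change mulBilin n r (x + y) z = mulBilin n r x z + mulBilin n r y z
    rw [map_add, LinearMap.add_apply]
  zero_mul x := by
    change mulBilin n r 0 x = 0
    rw [map_zero, LinearMap.zero_apply]
  mul_zero x := (mulBilin n r x).map_zero

theorem e_mul_e {n r : ℕ} (A B : Theta n r) :
    e A * e B = ∑ C : Theta n r, (structurePolynomial A B C).toLaurent • e C := by
  change mulBilin n r (e A) (e B) = _
  unfold mulBilin e
  erw [Finsupp.linearCombination_single, one_smul, Finsupp.linearCombination_single, one_smul]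

open Classical in
/-- The element `l_{A,r} = ∑_D e_{A+D}`, the sum over all diagonal matrices `D` of non-negative
integers for which the entries of `A + D` sum to `r`. -/
def l {n : ℕ} (A : Matrix (Fin n) (Fin n) ℕ) (r : ℕ) : QSchurAlgebra n r :=
  ∑ B : Theta n r with ∃ d : Fin n → ℕ, B.1 = A + Matrix.diagonal d, e B

/-- The element `E_i = l_{E_{i,i+1},r}`, where `E_{i,i+1}` is the elementary matrix. The index `i`
counts from zero: `E n r ⟨i, _⟩` is the element usually written with index `i + 1`. -/
def E (n r : ℕ) (i : Fin (n - 1)) : QSchurAlgebra n r :=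
  l (Matrix.single (⟨i, by omega⟩ : Fin n) (⟨i + 1, by omega⟩ : Fin n) 1) r

/-- The indeterminate `q` of `ℤ[q, q⁻¹]`. -/
def q : ℤ[T;T⁻¹] := LaurentPolynomial.T 1

end QSchur

end

/-! Setting `q = |K|` for a finite field `K` turns an element of `S_q(n,r)` into a rational function
on pairs of flags, constant on orbits. Read as a matrix indexed by flags (`rep`), such a function
multiplies by convolution, because the structure constants count intermediate flags. A Laurent
polynomial that vanishes at every prime is zero, and every orbit is non-empty over every field, so
an identity need only be checked under `rep` over all prime fields (`eq_of_rep_eq`).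

Compatibility of `rep` with a product requires the structure polynomials involved to exist. Every
product in the theorem has some `E_i` as a left or right factor, so existence is needed only when
`A` or `B` is `E_{i,i+1} + D`. There the counted flags correspond to hyperplanes, or one-dimensional
extensions, of a step, and their number is a difference of two `q`-integers
(`exists_isStructurePolynomial_left`, `exists_isStructurePolynomial_right`). Associativity then
comes from matrix multiplication.

The image of `E_i` is the 0-1 matrix of the relation `Adj`: `g` agrees with `f` except that its step
`i` is a hyperplane in that of `f` (`adj_iff`, `rep_E`). The relations become identities between
numbers of paths from `f` to `g`. In the Serre relations, with `s` and `t` the steps of `E_i` and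
`E_j`, a path is determined by a subspace `W` strictly between `G = g_s` and `F = f_s`, where `dim F
/ G = 2`, and the order of the factors only decides how `W`, `F`, `G` must sit relative to step `t`.
If that condition holds for `F` and `G` themselves, all three counts agree and `1 + q = q + 1`.
Otherwise one count is zero, and either the other two vanish as well or exactly one of the `q + 1`
subspaces `W` survives in the middle term. -/

noncomputable section

namespace QSchur

/-! ### Counting lines and hyperplanes in intervals of subspaces -/

section Counting

variable {K V : Type*} [Field K] [AddCommGroup V] [Module K V]

theorem covBy_iff_finrank [FiniteDimensional K V] {S T : Submodule K V} :
    S ⋖ T ↔ S ≤ T ∧ Module.finrank K T = Module.finrank K S + 1 := by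
  constructor
  · intro h
    refine ⟨h.le, ?_⟩
    have h1 := (covBy_iff_quot_is_simple h.le).1 h
    rw [isSimpleModule_iff_finrank_eq_one] at h1
    have h2 := Submodule.finrank_quotient_add_finrank (S.submoduleOf T)
    rw [(Submodule.submoduleOfEquivOfLe h.le).finrank_eq] at h2
    change Module.finrank K (T ⧸ S.submoduleOf T) = 1 at h1
    omega
  · rintro ⟨hle, h⟩
    rw [covBy_iff_quot_is_simple hle, isSimpleModule_iff_finrank_eq_one]
    have h2 := Submodule.finrank_quotient_add_finrank (S.submoduleOf T)
    rw [(Submodule.submoduleOfEquivOfLe hle).finrank_eq] at h2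
    change Module.finrank K (T ⧸ S.submoduleOf T) = 1
    omega

/-- The `q`-integer `1 + q + ⋯ + q ^ (d - 1)`. -/
def qInt (d : ℕ) : ℤ[X] := ∑ i ∈ Finset.range d, Polynomial.X ^ i

theorem eval_qInt (d k : ℕ) :
    (qInt d).eval (k : ℤ) = ((∑ i ∈ Finset.range d, k ^ i : ℕ) : ℤ) := by
  simp [qInt, Polynomial.eval_finsetSum]

theorem card_isAtom [Finite K] (d : ℕ) (h : Module.finrank K V = d) :
    {W : Submodule K V | IsAtom W}.ncard = ∑ i ∈ Finset.range d, Nat.card K ^ i := by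
  rw [← Projectivization.card_of_finrank K V h, Nat.card_congr (Projectivization.equivSubmodule K V)]
  simp_rw [Submodule.isAtom_iff_finrank_eq_one]
  rfl

/-- Taking annihilators reverses inclusion, so hyperplanes of `V` correspond to lines of the dual
space. -/
theorem card_isCoatom [Finite K] [FiniteDimensional K V] (d : ℕ) (h : Module.finrank K V = d) :
    {W : Submodule K V | IsCoatom W}.ncard = ∑ i ∈ Finset.range d, Nat.card K ^ i := by
  rw [← card_isAtom (K := K) (V := Module.Dual K V) d (by rw [Subspace.dual_finrank_eq, h])]
  let φ := Subspace.orderIsoFiniteDimensional (K := K) (V := V)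
  rw [← Set.ncard_image_of_injective _ (φ.injective)]
  have : φ '' {W : Submodule K V | IsCoatom W} =
      OrderDual.ofDual ⁻¹' {W : Submodule K (Module.Dual K V) | IsAtom W} := by
    ext W
    obtain ⟨U, rfl⟩ := φ.surjective W
    rw [φ.injective.mem_set_image, Set.mem_preimage, Set.mem_ofPred_eq, Set.mem_ofPred_eq,
      ← φ.isCoatom_iff, ← isCoatom_dual_iff_isAtom]
    rfl
  rw [this]
  rfl

/-- Subspaces of `T / S` as subspaces between `S` and `T`. -/
def intervalEmbedding (S T : Submodule K V) :
    Submodule K (T ⧸ S.submoduleOf T) ↪o Submodule K V :=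
  (Submodule.comapMkQOrderEmbedding (S.submoduleOf T)).trans
    (Submodule.MapSubtype.orderEmbedding T)

theorem range_intervalEmbedding {S T : Submodule K V} (h : S ≤ T) :
    Set.range (intervalEmbedding S T) = Set.Icc S T := by
  ext W
  constructor
  · rintro ⟨W, rfl⟩
    refine ⟨?_, Submodule.map_subtype_le T _⟩
    intro x hx
    refine ⟨⟨x, h hx⟩, ?_, rfl⟩
    change (S.submoduleOf T).mkQ ⟨x, h hx⟩ ∈ W
    rw [show (S.submoduleOf T).mkQ ⟨x, h hx⟩ = 0 from
      (Submodule.Quotient.mk_eq_zero _).2 hx]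
    exact W.zero_mem
  · rintro ⟨h1, h2⟩
    refine ⟨(W.submoduleOf T).map (S.submoduleOf T).mkQ, ?_⟩
    change (((W.submoduleOf T).map (S.submoduleOf T).mkQ).comap _).map T.subtype = W
    rw [Submodule.comap_map_mkQ, sup_eq_right.2 (Submodule.comap_mono h1),
      Submodule.submoduleOf, Submodule.map_comap_subtype, inf_eq_right.2 h2]

theorem intervalEmbedding_bot {S T : Submodule K V} (h : S ≤ T) :
    intervalEmbedding S T ⊥ = S := by
  obtain ⟨W, hW⟩ : S ∈ Set.range (intervalEmbedding S T) := by
    rw [range_intervalEmbedding h]; exact ⟨le_rfl, h⟩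
  apply le_antisymm
  · conv_rhs => rw [← hW]
    exact (intervalEmbedding S T).monotone bot_le
  · exact ((range_intervalEmbedding h).le ⟨⊥, rfl⟩).1

theorem intervalEmbedding_top {S T : Submodule K V} (h : S ≤ T) :
    intervalEmbedding S T ⊤ = T := by
  obtain ⟨W, hW⟩ : T ∈ Set.range (intervalEmbedding S T) := by
    rw [range_intervalEmbedding h]; exact ⟨h, le_rfl⟩
  apply le_antisymm
  · exact ((range_intervalEmbedding h).le ⟨⊤, rfl⟩).2
  · conv_lhs => rw [← hW]
    exact (intervalEmbedding S T).monotone le_top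

theorem finrank_quotient_submoduleOf [FiniteDimensional K V] {S T : Submodule K V} (h : S ≤ T) :
    Module.finrank K (T ⧸ S.submoduleOf T) = Module.finrank K T - Module.finrank K S := by
  have h2 := Submodule.finrank_quotient_add_finrank (S.submoduleOf T)
  rw [(Submodule.submoduleOfEquivOfLe h).finrank_eq] at h2
  omega

variable [Finite K] [FiniteDimensional K V]

/-- The range of `intervalEmbedding` is an interval, hence order-connected, so covering relations
are the same in `T / S` as in `V`. The count is that of lines in `T / S`. -/
theorem card_covBy_le {S T : Submodule K V} (h : S ≤ T) :
    {W | S ⋖ W ∧ W ≤ T}.ncard =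
      ∑ i ∈ Finset.range (Module.finrank K T - Module.finrank K S), Nat.card K ^ i := by
  rw [← card_isAtom _ (finrank_quotient_submoduleOf h),
    ← Set.ncard_image_of_injective _ (intervalEmbedding S T).injective]
  congr 1
  have hr := range_intervalEmbedding h
  have hc : (Set.range (intervalEmbedding S T)).OrdConnected := by
    rw [hr]
    exact Set.ordConnected_Icc
  have key : ∀ W, S ⋖ intervalEmbedding S T W ↔ IsAtom W := by
    intro W
    rw [← bot_covBy_iff, ← Set.OrdConnected.apply_covBy_apply_iff _ hc, intervalEmbedding_bot h]
  ext W
  constructor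
  · rintro ⟨h1, h2⟩
    obtain ⟨W, rfl⟩ := hr.ge ⟨h1.le, h2⟩
    exact ⟨W, (key W).1 h1, rfl⟩
  · rintro ⟨W, h1, rfl⟩
    exact ⟨(key W).2 h1, (hr.le ⟨W, rfl⟩).2⟩

theorem card_le_covBy {S T : Submodule K V} (h : S ≤ T) :
    {W | S ≤ W ∧ W ⋖ T}.ncard =
      ∑ i ∈ Finset.range (Module.finrank K T - Module.finrank K S), Nat.card K ^ i := by
  rw [← card_isCoatom _ (finrank_quotient_submoduleOf h),
    ← Set.ncard_image_of_injective _ (intervalEmbedding S T).injective]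
  congr 1
  have hr := range_intervalEmbedding h
  have hc : (Set.range (intervalEmbedding S T)).OrdConnected := by
    rw [hr]
    exact Set.ordConnected_Icc
  have key : ∀ W, intervalEmbedding S T W ⋖ T ↔ IsCoatom W := by
    intro W
    rw [← covBy_top_iff, ← Set.OrdConnected.apply_covBy_apply_iff _ hc, intervalEmbedding_top h]
  ext W
  constructor
  · rintro ⟨h1, h2⟩
    obtain ⟨W, rfl⟩ := hr.ge ⟨h1, h2.le⟩
    exact ⟨W, (key W).1 h2, rfl⟩
  · rintro ⟨W, h1, rfl⟩
    exact ⟨(hr.le ⟨W, rfl⟩).1, (key W).2 h1⟩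

end Counting


/-! ### Corner sums of matrices -/

section PartialSums

variable {n : ℕ}

/-- The sum of the first `i` values of `g`. -/
def psum (g : Fin n → ℕ) (i : Fin (n + 1)) : ℕ := ∑ k with k.castSucc < i, g k

theorem psum_zero (g : Fin n → ℕ) : psum g 0 = 0 := by
  simp [psum]

theorem psum_succ (g : Fin n → ℕ) (i : Fin n) : psum g i.succ = psum g i.castSucc + g i := by
  have : (Finset.univ.filter fun k : Fin n => k.castSucc < i.succ) =
      insert i (Finset.univ.filter fun k : Fin n => k.castSucc < i.castSucc) := by
    ext k
    simp only [Finset.mem_filter_univ, Finset.mem_insert, Fin.lt_def, Fin.ext_iff, Fin.val_castSucc,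
      Fin.val_succ]
    omega
  rw [psum, this, Finset.sum_insert (by simp), add_comm]
  rfl

theorem psum_last (g : Fin n → ℕ) : psum g (Fin.last n) = ∑ k, g k := by
  simp [psum, Fin.castSucc_lt_last]

/-- The sum of the entries of the top left `i × j` block of `A`. -/
def corner (A : Matrix (Fin n) (Fin n) ℕ) (i j : Fin (n + 1)) : ℕ :=
  psum (fun i' => psum (A i') j) i

theorem corner_add (A B : Matrix (Fin n) (Fin n) ℕ) (i j : Fin (n + 1)) :
    corner (A + B) i j = corner A i j + corner B i j := by
  simp [corner, psum, Finset.sum_add_distrib]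

theorem corner_single (a b : Fin n) (i j : Fin (n + 1)) :
    corner (Matrix.single a b 1) i j = if a.castSucc < i ∧ b.castSucc < j then 1 else 0 := by
  simp only [corner, psum, Matrix.single, Matrix.of_apply, Finset.sum_filter]
  rw [Finset.sum_eq_single a, Finset.sum_eq_single b]
  · by_cases h1 : a.castSucc < i <;> by_cases h2 : b.castSucc < j <;> simp [h1, h2]
  · intro k _ hk
    simp [hk.symm]
  · simp
  · intro k _ hk
    simp [hk.symm]
  · simp

theorem corner_diagonal (d : Fin n → ℕ) (i j : Fin (n + 1)) :
    corner (Matrix.diagonal d) i j = psum d (min i j) := by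
  simp only [corner, psum, Finset.sum_filter, Matrix.diagonal_apply]
  refine Finset.sum_congr rfl fun k _ => ?_
  rw [Finset.sum_eq_single k]
  · by_cases h1 : k.castSucc < i <;> by_cases h2 : k.castSucc < j <;> simp [h1, h2]
  · intro l _ hl
    simp [hl.symm]
  · simp

end PartialSums

/-! ### Relative positions and dimensions of intersections -/

section RelPos

variable {K : Type} [Field K] {n r : ℕ}

theorem Flag.ext_step {f g : Flag K n r} (h : ∀ k, f.step k = g.step k) : f = g := by
  cases f
  cases g
  congr
  exact funext h

instance [Finite K] : Finite (Flag K n r) :=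
  Finite.of_injective Flag.step fun _ _ h => Flag.ext_step (congrFun h)

/-- The dimension of the intersection of two steps of two flags. -/
def interDim (f g : Flag K n r) (i j : Fin (n + 1)) : ℕ :=
  Module.finrank K ↥(f.step i ⊓ g.step j)

theorem interDim_last_right (f g : Flag K n r) (i : Fin (n + 1)) :
    interDim f g i (Fin.last n) = Module.finrank K (f.step i) := by
  rw [interDim, g.step_last, inf_top_eq]

theorem interDim_last_left (f g : Flag K n r) (j : Fin (n + 1)) :
    interDim f g (Fin.last n) j = Module.finrank K (g.step j) := by
  rw [interDim, f.step_last, top_inf_eq]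

theorem interDim_zero_right (f g : Flag K n r) (i : Fin (n + 1)) : interDim f g i 0 = 0 := by
  rw [interDim, g.step_zero, inf_bot_eq, finrank_bot]

theorem finrank_step_sup (f g : Flag K n r) {k i : Fin (n + 1)} (h : k ≤ i) (j : Fin (n + 1)) :
    Module.finrank K ↥(f.step k ⊔ (f.step i ⊓ g.step j)) + interDim f g k j =
      Module.finrank K (f.step k) + interDim f g i j := by
  have := Submodule.finrank_sup_add_finrank_inf_eq (f.step k) (f.step i ⊓ g.step j)
  rwa [← inf_assoc, inf_eq_left.2 (f.mono h)] at this

theorem relPos_add (f g : Flag K n r) (i j : Fin n) :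
    relPos f g i j + interDim f g i.succ j.castSucc + interDim f g i.castSucc j.succ =
      interDim f g i.succ j.succ + interDim f g i.castSucc j.castSucc := by
  have h1 := finrank_step_sup f g i.castSucc_lt_succ.le j.succ
  have h2 := finrank_step_sup f g i.castSucc_lt_succ.le j.castSucc
  have h3 : Module.finrank K ↥(f.step i.castSucc ⊔ (f.step i.succ ⊓ g.step j.castSucc)) ≤
      Module.finrank K ↥(f.step i.castSucc ⊔ (f.step i.succ ⊓ g.step j.succ)) :=
    Submodule.finrank_mono
      (sup_le_sup_left (inf_le_inf_left _ (g.mono j.castSucc_lt_succ.le)) _)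
  have h4 : relPos f g i j = Module.finrank K
      ↥(f.step i.castSucc ⊔ (f.step i.succ ⊓ g.step j.succ)) - Module.finrank K
      ↥(f.step i.castSucc ⊔ (f.step i.succ ⊓ g.step j.castSucc)) := rfl
  omega

/-- By `relPos_add` the relative position is the mixed second difference of the intersection
dimensions, so summing it over a corner recovers them. -/
theorem interDim_eq_corner (f g : Flag K n r) (i j : Fin (n + 1)) :
    interDim f g i j = corner (relPos f g) i j := by
  induction i using Fin.induction generalizing j with
  | zero => simp [interDim, f.step_zero, corner, psum_zero]
  | succ i ih =>
    rw [corner, psum_succ, ← corner, ← ih]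
    induction j using Fin.induction with
    | zero => simp [interDim_zero_right, psum_zero]
    | succ j ihj =>
      rw [psum_succ]
      have := relPos_add f g i j
      omega

theorem relPos_eq_iff {f g : Flag K n r} {A : Matrix (Fin n) (Fin n) ℕ} :
    relPos f g = A ↔ ∀ i j, interDim f g i j = corner A i j := by
  constructor
  · rintro rfl i j
    exact interDim_eq_corner f g i j
  · intro h
    ext i j
    have := relPos_add f g i j
    simp only [h] at this
    simp only [corner, psum_succ] at this
    omega

theorem sum_relPos (f g : Flag K n r) : ∑ i, ∑ j, relPos f g i j = r := by
  have := interDim_eq_corner f g (Fin.last n) (Fin.last n)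
  rw [interDim_last_right, f.step_last, finrank_top, Module.finrank_fin_fun] at this
  simpa only [corner, psum_last] using this.symm

/-- The relative position of two flags, as an element of `Theta n r`. -/
def position (f g : Flag K n r) : Theta n r := ⟨relPos f g, sum_relPos f g⟩

theorem mem_orbit_iff {f g : Flag K n r} {A : Theta n r} :
    (f, g) ∈ orbit K A ↔ position f g = A :=
  ⟨fun h => Subtype.ext h, fun h => congrArg Subtype.val h⟩

variable (K) in
/-- The subspace of the vectors that vanish outside `S`. -/
def coordSubspace (S : Set (Fin r)) : Submodule K (Fin r → K) :=
  ⨅ x ∈ Sᶜ, LinearMap.ker (LinearMap.proj x : (Fin r → K) →ₗ[K] K)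

theorem mem_coordSubspace {S : Set (Fin r)} {v : Fin r → K} :
    v ∈ coordSubspace K S ↔ ∀ x, x ∉ S → v x = 0 := by
  simp [coordSubspace]

theorem finrank_coordSubspace (S : Set (Fin r)) :
    Module.finrank K (coordSubspace K S) = S.ncard := by
  classical
  rw [coordSubspace, (LinearMap.iInfKerProjEquiv K (fun _ : Fin r => K)
    (I := S) (J := Sᶜ) disjoint_compl_right (by simp)).finrank_eq]
  rw [Module.finrank_fintype_fun_eq_card, ← Nat.card_eq_fintype_card]
  rfl

theorem coordSubspace_inf (S T : Set (Fin r)) :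
    coordSubspace K S ⊓ coordSubspace K T = coordSubspace K (S ∩ T) := by
  ext v
  simp only [Submodule.mem_inf, mem_coordSubspace, Set.mem_inter_iff]
  constructor
  · rintro ⟨h1, h2⟩ x hx
    by_cases h : x ∈ S
    · exact h2 x fun h' => hx ⟨h, h'⟩
    · exact h1 x h
  · intro h
    exact ⟨fun x hx => h x fun h' => hx h'.1, fun x hx => h x fun h' => hx h'.2⟩

variable (K) in
/-- The coordinate flag that is given by a colouring of the coordinates. -/
def coordFlag (c : Fin r → Fin n) : Flag K n r where
  step i := coordSubspace K {x | (c x).castSucc < i}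
  mono i j h v hv := by
    rw [mem_coordSubspace] at hv ⊢
    exact fun x hx => hv x fun h' => hx (lt_of_lt_of_le h' h)
  step_zero := by
    rw [eq_bot_iff]
    intro v hv
    rw [mem_coordSubspace] at hv
    exact (Submodule.mem_bot K).2 (funext fun x => hv x (by simp))
  step_last := by
    rw [eq_top_iff]
    intro v _
    rw [mem_coordSubspace]
    exact fun x hx => absurd (Fin.castSucc_lt_last _) hx

-- Split the coordinates into blocks indexed by `(i, j)` with `A i j` members each. The first flag
-- collects blocks by `i`, the second by `j`, and intersections of coordinate subspaces are counted
-- by corner sums.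
variable (K) in
theorem exists_position_eq (A : Theta n r) : ∃ f g : Flag K n r, position f g = A := by
  obtain ⟨A, hA⟩ := A
  let B : Fin n → Fin n → ℕ := fun i j => A i j
  have hcard : Fintype.card (Σ p : Fin n × Fin n, Fin (B p.1 p.2)) = r := by
    simp [Fintype.sum_prod_type, B, hA]
  let φ := (Fintype.equivFinOfCardEq hcard).symm
  refine ⟨coordFlag K fun x => (φ x).1.1, coordFlag K fun x => (φ x).1.2, Subtype.ext ?_⟩
  refine relPos_eq_iff.2 fun i j => ?_
  change Module.finrank K ↥(coordSubspace K _ ⊓ coordSubspace K _) = _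
  rw [coordSubspace_inf, finrank_coordSubspace,
    ← Set.ncard_image_of_injective _ φ.injective, φ.image_eq_preimage_symm]
  simp only [Set.preimage_inter, Set.preimage_ofPred_eq, Equiv.apply_symm_apply]
  rw [← Set.ofPred_and, Set.ncard_eq_toFinset_card', Set.toFinset_ofPred, Finset.card_filter,
    Fintype.sum_sigma, Fintype.sum_prod_type]
  simp only [corner, psum, Finset.sum_filter]
  refine Finset.sum_congr rfl fun k _ => ?_
  by_cases h1 : k.castSucc < i
  · simp only [h1, true_and, if_true]
    refine Finset.sum_congr rfl fun l _ => ?_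
    by_cases h2 : l.castSucc < j <;> simp [h2, B]
  · simp [h1]

end RelPos

/-! ### Adjacent flags and the matrices `E_{i,i+1} + D` -/

section Adjacent

variable {K : Type} [Field K] {n r : ℕ}

/-- The flags `f` and `g` differ only in step `h`, where `g` is a hyperplane of `f`. -/
def Adj (h : Fin (n + 1)) (f g : Flag K n r) : Prop :=
  (∀ k, k ≠ h → f.step k = g.step k) ∧ g.step h ⋖ f.step h

theorem Adj.le {h : Fin (n + 1)} {f g : Flag K n r} (H : Adj h f g) (k : Fin (n + 1)) :
    g.step k ≤ f.step k := by
  by_cases hk : k = h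
  · subst hk; exact H.2.le
  · exact (H.1 k hk).ge

theorem Adj.le_of_lt {h : Fin (n + 1)} {f g : Flag K n r} (H : Adj h f g) {k l : Fin (n + 1)}
    (hkl : k < l) : f.step k ≤ g.step l := by
  by_cases hk : k = h
  · exact (f.mono hkl.le).trans (H.1 l (by rintro rfl; exact hkl.ne hk)).le
  · exact (H.1 k hk).le.trans (g.mono hkl.le)

theorem Adj.finrank {h : Fin (n + 1)} {f g : Flag K n r} (H : Adj h f g) (k : Fin (n + 1)) :
    Module.finrank K (f.step k) = Module.finrank K (g.step k) + if k = h then 1 else 0 := by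
  by_cases hk : k = h
  · subst hk
    simpa using (covBy_iff_finrank.1 H.2).2
  · rw [H.1 k hk, if_neg hk, add_zero]

/-- The steps interlace: `f_{i-1} ≤ g_i ≤ f_i ≤ g_{i+1}`. Row `i` therefore has only two entries
that can be non-zero: `dim g_i / f_{i-1}` on the diagonal and `dim f_i / g_i` just to its right, the
latter being 1 in row `a` and 0 elsewhere. -/
theorem Adj.exists_relPos_eq {a b : Fin n} (hab : (b : ℕ) = a + 1) {f g : Flag K n r}
    (H : Adj a.succ f g) :
    ∃ d, relPos f g = Matrix.single a b 1 + Matrix.diagonal d := by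
  refine ⟨fun i => Module.finrank K (g.step i.succ) - Module.finrank K (f.step i.castSucc), ?_⟩
  have low : ∀ (i : Fin n) (j : Fin (n + 1)), j ≤ i.castSucc →
      f.step i.castSucc ⊔ (f.step i.succ ⊓ g.step j) = f.step i.castSucc := fun i j hj =>
    sup_eq_left.2 (inf_le_right.trans ((H.le j).trans (f.mono hj)))
  have mid : ∀ i : Fin n,
      f.step i.castSucc ⊔ (f.step i.succ ⊓ g.step i.succ) = g.step i.succ := fun i => by
    rw [inf_eq_right.2 (H.le _), sup_eq_right.2 (H.le_of_lt i.castSucc_lt_succ)]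
  have high : ∀ (i : Fin n) (j : Fin (n + 1)), i.succ < j →
      f.step i.castSucc ⊔ (f.step i.succ ⊓ g.step j) = f.step i.succ := fun i j hj => by
    rw [inf_eq_left.2 (H.le_of_lt hj), sup_eq_right.2 (f.mono i.castSucc_lt_succ.le)]
  ext i j
  simp only [relPos, Matrix.of_apply, Matrix.add_apply, Matrix.single, Matrix.diagonal_apply]
  rcases lt_trichotomy j i with h | rfl | h
  · rw [low i j.succ (by simpa [Fin.le_def] using h), low i j.castSucc (by simpa using h.le),
      if_neg, if_neg h.ne', Nat.sub_self, add_zero]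
    rintro ⟨rfl, rfl⟩
    rw [Fin.lt_def] at h
    omega
  · rw [mid, low j j.castSucc le_rfl, if_pos rfl, if_neg, zero_add]
    simp only [Fin.ext_iff]
    omega
  · rw [high i j.succ (by simpa using h), if_neg h.ne, add_zero]
    by_cases h' : (j : ℕ) = i + 1
    · have : j.castSucc = i.succ := by simpa [Fin.ext_iff] using h'
      rw [this, mid, H.finrank, Nat.add_sub_cancel_left]
      refine if_congr ?_ rfl rfl
      simp only [Fin.ext_iff, Fin.val_succ]
      omega
    · rw [high i j.castSucc, if_neg, Nat.sub_self]
      · simp only [Fin.ext_iff]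
        omega
      · simp only [Fin.lt_def, Fin.val_succ, Fin.val_castSucc] at h ⊢
        omega

/-- The corner sums give `dim (f_i ∩ g_i) = dim g_i`, hence `g_i ≤ f_i`. The last column and last
row of corner sums give the dimensions of the steps, which differ only at `a.succ`. -/
theorem adj_of_relPos_eq {a b : Fin n} (hab : (b : ℕ) = a + 1) {f g : Flag K n r} {d : Fin n → ℕ}
    (H : relPos f g = Matrix.single a b 1 + Matrix.diagonal d) : Adj a.succ f g := by
  have key : ∀ i j, interDim f g i j =
      (if a.castSucc < i ∧ b.castSucc < j then 1 else 0) + psum d (min i j) := by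
    intro i j
    rw [interDim_eq_corner, H, corner_add, corner_single, corner_diagonal]
  have hf : ∀ i, Module.finrank K (f.step i) = (if a.castSucc < i then 1 else 0) + psum d i := by
    intro i
    simpa [interDim_last_right, Fin.castSucc_lt_last, Fin.le_last] using key i (Fin.last n)
  have hg : ∀ i, Module.finrank K (g.step i) = (if b.castSucc < i then 1 else 0) + psum d i := by
    intro i
    simpa [interDim_last_left, Fin.castSucc_lt_last, Fin.le_last] using key (Fin.last n) i
  have hle : ∀ i, g.step i ≤ f.step i := by
    intro i
    have h1 : interDim f g i i = Module.finrank K (g.step i) := by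
      rw [key, hg, min_self]
      congr 1
      refine if_congr ?_ rfl rfl
      simp only [Fin.lt_def, Fin.val_castSucc]
      omega
    rw [← Submodule.eq_of_le_of_finrank_eq inf_le_right h1]
    exact inf_le_left
  constructor
  · intro k hk
    refine (Submodule.eq_of_le_of_finrank_eq (hle k) ?_).symm
    rw [hf, hg]
    congr 1
    refine if_congr ?_ rfl rfl
    simp only [Fin.lt_def, Fin.val_castSucc, ne_eq, Fin.ext_iff, Fin.val_succ] at hk ⊢
    omega
  · refine covBy_iff_finrank.2 ⟨hle _, ?_⟩
    rw [hf, hg, if_pos (by simp [Fin.lt_def]), if_neg (by simp [Fin.lt_def, hab])]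
    omega

theorem adj_iff {a b : Fin n} (hab : (b : ℕ) = a + 1) {f g : Flag K n r} :
    Adj a.succ f g ↔ ∃ d, relPos f g = Matrix.single a b 1 + Matrix.diagonal d :=
  ⟨Adj.exists_relPos_eq hab, fun ⟨_, h⟩ => adj_of_relPos_eq hab h⟩

end Adjacent


/-! ### Intersections with a subspace and its hyperplane -/

section Covering

variable {K V : Type*} [Field K] [AddCommGroup V] [Module K V]

theorem sup_inf_eq_of_covBy {H U X : Submodule K V} (h : H ⋖ U) (hX : ¬ X ⊓ U ≤ H) :
    H ⊔ X ⊓ U = U := by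
  rcases h.eq_or_eq le_sup_left (sup_le h.le inf_le_right) with h' | h'
  · exact absurd (sup_eq_left.1 h') hX
  · exact h'

/-- The converse direction is the modular law. The right side bounds `U` by a subspace independent
of `U`, so the admissible `U` can be counted by `card_covBy_le`. -/
theorem not_inf_le_iff_of_covBy {H U X Z : Submodule K V} (h : H ⋖ U) (hZ : U ≤ Z) :
    ¬ X ⊓ U ≤ H ↔ U ≤ H ⊔ X ⊓ Z := by
  constructor
  · intro hX
    rw [← sup_inf_eq_of_covBy h hX]
    exact sup_le_sup_left (inf_le_inf_left _ hZ) _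
  · intro hU hX
    have h1 : U ≤ H ⊔ X ⊓ Z ⊓ U := by
      rw [← sup_inf_assoc_of_le _ h.le]
      exact le_inf hU le_rfl
    refine h.lt.not_ge (h1.trans (sup_le le_rfl (le_trans ?_ hX)))
    exact inf_le_inf_right _ inf_le_left

open Classical in
theorem finrank_inf_of_covBy [FiniteDimensional K V] {H U : Submodule K V} (h : H ⋖ U)
    (X : Submodule K V) :
    Module.finrank K ↥(X ⊓ U) = Module.finrank K ↥(X ⊓ H) + if X ⊓ U ≤ H then 0 else 1 := by
  split_ifs with hX
  · rw [add_zero]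
    rw [le_antisymm (le_inf inf_le_left hX) (inf_le_inf_left X h.le)]
  · have h1 := Submodule.finrank_sup_add_finrank_inf_eq H (X ⊓ U)
    have h2 : H ⊓ (X ⊓ U) = X ⊓ H := by
      rw [inf_left_comm, inf_eq_left.2 h.le]
    rw [sup_inf_eq_of_covBy h hX, h2, (covBy_iff_finrank.1 h).2] at h1
    omega

end Covering

theorem exists_threshold {n : ℕ} {P : Fin (n + 1) → Prop} (h0 : P 0) (hl : ¬ P (Fin.last n))
    (hP : ∀ i j, i ≤ j → P j → P i) :
    ∃ p : Fin n, (∀ j, j ≤ p.castSucc → P j) ∧ ∀ j, p.castSucc < j → ¬ P j := by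
  by_contra! hcon
  refine hl (Fin.induction h0 (fun i hi => ?_) (Fin.last n))
  obtain ⟨j, hj, hPj⟩ := hcon i fun j hj => hP _ _ hj hi
  exact hP _ _ (Fin.castSucc_lt_iff_succ_le.1 hj) hPj

/-! ### Existence of the structure polynomials with a factor `E_{i,i+1} + D` -/

section Existence

variable {K : Type} [Field K] {n r : ℕ}

theorem interDim_comm (f g : Flag K n r) (i j : Fin (n + 1)) :
    interDim f g i j = interDim g f j i := by
  rw [interDim, interDim, inf_comm]

theorem psum_injective {d d' : Fin n → ℕ} (h : ∀ i, psum d i = psum d' i) : d = d' := by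
  funext i
  have := h i.succ
  rw [psum_succ, psum_succ, h] at this
  omega

/-- The row sums and adjacency determine whether the relative position is `E_{i,i+1} + D`. -/
theorem relPos_eq_single_add_diagonal_iff_left {a b : Fin n} (hab : (b : ℕ) = a + 1)
    {f g : Flag K n r} {d : Fin n → ℕ} :
    relPos f g = Matrix.single a b 1 + Matrix.diagonal d ↔
      Adj a.succ f g ∧ ∀ i, Module.finrank K (f.step i) =
        corner (Matrix.single a b 1 + Matrix.diagonal d) i (Fin.last n) := by
  constructor
  · intro h
    refine ⟨adj_of_relPos_eq hab h, fun i => ?_⟩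
    rw [← h, ← interDim_eq_corner, interDim_last_right]
  · rintro ⟨h, hd⟩
    obtain ⟨d', hd'⟩ := h.exists_relPos_eq hab
    suffices d' = d by rw [hd', this]
    refine psum_injective fun i => ?_
    have := hd i
    rw [← interDim_last_right f g, interDim_eq_corner, hd', corner_add, corner_add,
      corner_diagonal, corner_diagonal, min_eq_left (Fin.le_last i)] at this
    omega

theorem relPos_eq_single_add_diagonal_iff_right {a b : Fin n} (hab : (b : ℕ) = a + 1)
    {f g : Flag K n r} {d : Fin n → ℕ} :
    relPos f g = Matrix.single a b 1 + Matrix.diagonal d ↔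
      Adj a.succ f g ∧ ∀ i, Module.finrank K (g.step i) =
        corner (Matrix.single a b 1 + Matrix.diagonal d) (Fin.last n) i := by
  constructor
  · intro h
    refine ⟨adj_of_relPos_eq hab h, fun i => ?_⟩
    rw [← h, ← interDim_eq_corner, interDim_last_left]
  · rintro ⟨h, hd⟩
    obtain ⟨d', hd'⟩ := h.exists_relPos_eq hab
    suffices d' = d by rw [hd', this]
    refine psum_injective fun i => ?_
    have := hd i
    rw [← interDim_last_left f g, interDim_eq_corner, hd', corner_add, corner_add,
      corner_diagonal, corner_diagonal, min_eq_right (Fin.le_last i)] at this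
    omega

/-- Replace one step of a flag. -/
def Flag.replace (f : Flag K n r) (h : Fin (n + 1)) (W : Submodule K (Fin r → K))
    (h0 : 0 < h) (hl : h < Fin.last n) (lower : ∀ k < h, f.step k ≤ W)
    (upper : ∀ k, h < k → W ≤ f.step k) : Flag K n r where
  step := Function.update f.step h W
  mono i j hij := by
    by_cases hi : i = h <;> by_cases hj : j = h
    · rw [hi, hj]
    · subst hi
      rw [Function.update_self, Function.update_of_ne hj]
      exact upper j (lt_of_le_of_ne hij (Ne.symm hj))
    · subst hj
      rw [Function.update_self, Function.update_of_ne hi]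
      exact lower i (lt_of_le_of_ne hij hi)
    · rw [Function.update_of_ne hi, Function.update_of_ne hj]
      exact f.mono hij
  step_zero := by rw [Function.update_of_ne h0.ne, f.step_zero]
  step_last := by rw [Function.update_of_ne hl.ne', f.step_last]

theorem Flag.replace_step_self (f : Flag K n r) (h : Fin (n + 1)) (W : Submodule K (Fin r → K))
    (h0 : 0 < h) (hl : h < Fin.last n) (lower : ∀ k < h, f.step k ≤ W)
    (upper : ∀ k, h < k → W ≤ f.step k) : (f.replace h W h0 hl lower upper).step h = W :=
  Function.update_self ..

theorem ncard_adj_right {a b : Fin n} (hab : (b : ℕ) = a + 1) (f : Flag K n r)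
    (P : Submodule K (Fin r → K) → Prop) :
    {g | Adj a.succ f g ∧ P (g.step a.succ)}.ncard =
      {W | (f.step a.castSucc ≤ W ∧ W ⋖ f.step a.succ) ∧ P W}.ncard := by
  have hinj : Set.InjOn (fun g : Flag K n r => g.step a.succ)
      {g | Adj a.succ f g ∧ P (g.step a.succ)} := by
    rintro g ⟨hg, -⟩ g' ⟨hg', -⟩ h
    refine Flag.ext_step fun k => ?_
    by_cases hk : k = a.succ
    · rw [hk]; exact h
    · rw [← hg.1 k hk, hg'.1 k hk]
  rw [← hinj.ncard_image]
  congr 1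
  ext W
  constructor
  · rintro ⟨g, ⟨hg, hP⟩, rfl⟩
    exact ⟨⟨hg.le_of_lt a.castSucc_lt_succ, hg.2⟩, hP⟩
  · rintro ⟨⟨h1, h2⟩, hP⟩
    refine ⟨f.replace a.succ W a.succ_pos (by simp [Fin.lt_def]; omega)
      (fun k hk => (f.mono (Fin.le_castSucc_iff.2 hk)).trans h1)
      (fun k hk => h2.le.trans (f.mono hk.le)), ⟨⟨fun k hk => ?_, ?_⟩, ?_⟩, ?_⟩
    · exact (Function.update_of_ne hk _ _).symm
    · rwa [Flag.replace_step_self]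
    · rwa [Flag.replace_step_self]
    · exact Function.update_self ..

theorem ncard_adj_left {a b : Fin n} (hab : (b : ℕ) = a + 1) (f : Flag K n r)
    (P : Submodule K (Fin r → K) → Prop) :
    {g | Adj a.succ g f ∧ P (g.step a.succ)}.ncard =
      {W | (f.step a.succ ⋖ W ∧ W ≤ f.step b.succ) ∧ P W}.ncard := by
  have hab' : a.succ = b.castSucc := by simp [Fin.ext_iff, hab]
  have hinj : Set.InjOn (fun g : Flag K n r => g.step a.succ)
      {g | Adj a.succ g f ∧ P (g.step a.succ)} := by
    rintro g ⟨hg, -⟩ g' ⟨hg', -⟩ h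
    refine Flag.ext_step fun k => ?_
    by_cases hk : k = a.succ
    · rw [hk]; exact h
    · rw [hg.1 k hk, hg'.1 k hk]
  rw [← hinj.ncard_image]
  congr 1
  ext W
  constructor
  · rintro ⟨g, ⟨hg, hP⟩, rfl⟩
    exact ⟨⟨hg.2, hg.le_of_lt (by rw [hab']; exact b.castSucc_lt_succ)⟩, hP⟩
  · rintro ⟨⟨h1, h2⟩, hP⟩
    refine ⟨f.replace a.succ W a.succ_pos (by simp [Fin.lt_def]; omega)
      (fun k hk => (f.mono hk.le).trans h1.le)
      (fun k hk => h2.trans (f.mono (Fin.castSucc_lt_iff_succ_le.1 (hab' ▸ hk)))),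
      ⟨⟨fun k hk => ?_, ?_⟩, ?_⟩, ?_⟩
    · exact Function.update_of_ne hk _ _
    · rwa [Flag.replace_step_self]
    · rwa [Flag.replace_step_self]
    · exact Function.update_self ..

theorem isStructurePolynomial_zero {A B C : Theta n r}
    (h : ∀ (K : Type) [Field K] (f f₁ f₂ : Flag K n r), relPos f₁ f₂ = C.1 →
      relPos f₁ f = A.1 → relPos f f₂ = B.1 → False) : IsStructurePolynomial A B C 0 := by
  intro K _ _ f₁ f₂ hC
  rw [Polynomial.eval_zero, Nat.cast_eq_zero, Set.ncard_eq_zero]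
  exact Set.eq_empty_of_forall_notMem fun f hf => h K f f₁ f₂ hC hf.1 hf.2

/-- The function `c'` agrees with `c` up to the threshold `p` and exceeds it by one from there on. -/
def IsThreshold (c c' : Fin (n + 1) → ℕ) (p : Fin n) : Prop :=
  (∀ j, j ≤ p.castSucc → c' j = c j) ∧ ∀ j, p.castSucc < j → c' j = c j + 1

theorem IsThreshold.eq_left {c₁ c₂ c' : Fin (n + 1) → ℕ} {p : Fin n} (h₁ : IsThreshold c₁ c' p)
    (h₂ : IsThreshold c₂ c' p) (j : Fin (n + 1)) : c₁ j = c₂ j := by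
  rcases le_or_gt j p.castSucc with hj | hj
  · rw [← h₁.1 j hj, h₂.1 j hj]
  · have := h₁.2 j hj
    have := h₂.2 j hj
    omega

theorem IsThreshold.eq_right {c c₁ c₂ : Fin (n + 1) → ℕ} {p : Fin n} (h₁ : IsThreshold c c₁ p)
    (h₂ : IsThreshold c c₂ p) (j : Fin (n + 1)) : c₁ j = c₂ j := by
  rcases le_or_gt j p.castSucc with hj | hj
  · rw [h₁.1 j hj, h₂.1 j hj]
  · rw [h₁.2 j hj, h₂.2 j hj]

theorem isThreshold_finrank_inf_iff {H U : Submodule K (Fin r → K)} (h : H ⋖ U) (f : Flag K n r)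
    (p : Fin n) :
    IsThreshold (fun j => Module.finrank K ↥(f.step j ⊓ H))
        (fun j => Module.finrank K ↥(f.step j ⊓ U)) p ↔
      f.step p.castSucc ⊓ U ≤ H ∧ ¬ f.step p.succ ⊓ U ≤ H := by
  have hmono : ∀ i j, i ≤ j → f.step j ⊓ U ≤ H → f.step i ⊓ U ≤ H := fun i j hij hj =>
    (inf_le_inf_right _ (f.mono hij)).trans hj
  simp only [IsThreshold, finrank_inf_of_covBy h]
  constructor
  · rintro ⟨h1, h2⟩
    constructor
    · by_contra hcon
      simpa [hcon] using h1 _ le_rfl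
    · intro hcon
      simpa [hcon] using h2 _ p.castSucc_lt_succ
  · rintro ⟨h1, h2⟩
    constructor
    · intro j hj
      rw [if_pos (hmono _ _ hj h1), add_zero]
    · intro j hj
      rw [if_neg fun h' => h2 (hmono _ _ (Fin.castSucc_lt_iff_succ_le.1 hj) h')]

/-- Passing from `H` to `U` raises the dimension of an intersection by 0 or 1. Along a flag the jump
starts at 0, ends at 1 and never drops back. -/
theorem exists_isThreshold {H U : Submodule K (Fin r → K)} (h : H ⋖ U) (f : Flag K n r) :
    ∃ p, IsThreshold (fun j => Module.finrank K ↥(f.step j ⊓ H))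
        (fun j => Module.finrank K ↥(f.step j ⊓ U)) p := by
  obtain ⟨p, h1, h2⟩ := exists_threshold (P := fun j => f.step j ⊓ U ≤ H)
    (by simp [f.step_zero]) (by simpa [f.step_last] using h.lt.not_ge)
    fun i j hij hj => (inf_le_inf_right _ (f.mono hij)).trans hj
  exact ⟨p, (isThreshold_finrank_inf_iff h f p).2 ⟨h1 _ le_rfl, h2 _ p.castSucc_lt_succ⟩⟩

theorem interDim_congr_left {f f' g : Flag K n r} {i : Fin (n + 1)} (h : f.step i = f'.step i)
    (j : Fin (n + 1)) : interDim f g i j = interDim f' g i j := by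
  rw [interDim, interDim, h]

theorem finrank_step_inf (f g : Flag K n r) (i j : Fin (n + 1)) :
    Module.finrank K ↥(f.step i ⊓ g.step j) = interDim f g i j := rfl

theorem interDim_eq_right (f g : Flag K n r) (i j : Fin (n + 1)) :
    interDim f g i j = Module.finrank K ↥(g.step j ⊓ f.step i) :=
  interDim_comm f g i j

theorem natCast_sub_eq_eval {x y u v k : ℕ} {s t : Set (Submodule K (Fin r → K))}
    [Finite K] (hst : s ⊆ t)
    (hs : s.ncard = ∑ i ∈ Finset.range x, k ^ i) (ht : t.ncard = ∑ i ∈ Finset.range y, k ^ i)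
    (hu : x = u) (hv : y = v) :
    (((t \ s).ncard : ℕ) : ℤ) = (qInt v - qInt u).eval (k : ℤ) := by
  subst hu hv
  rw [Set.ncard_sdiff hst (Set.toFinite _), Nat.cast_sub (Set.ncard_le_ncard hst (Set.toFinite _)),
    hs, ht, Polynomial.eval_sub, eval_qInt, eval_qInt]

/-- The flag `f` is given by a hyperplane `W` of `U = f₁.step a.succ` containing the previous step.
Its position to `f₂` is fixed by the threshold `p` at which `f₂.step j ⊓ U` ceases to lie in `W`. So
`W` contains `S p.castSucc` but not `S p.succ`, which gives a difference of two `q`-integers. If `C`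
violates a necessary condition, the polynomial is 0. -/
theorem exists_isStructurePolynomial_left {a b : Fin n} (hab : (b : ℕ) = a + 1) {A : Theta n r}
    {d : Fin n → ℕ} (hA : A.1 = Matrix.single a b 1 + Matrix.diagonal d) (B C : Theta n r) :
    ∃ p, IsStructurePolynomial A B C p := by
  by_cases hrow : ∀ i, corner C.1 i (Fin.last n) = corner A.1 i (Fin.last n)
  swap
  · refine ⟨0, isStructurePolynomial_zero fun K _ f f₁ f₂ hC hfA hB => hrow fun i => ?_⟩
    rw [← hC, ← hfA, ← interDim_eq_corner, ← interDim_eq_corner, interDim_last_right,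
      interDim_last_right]
  by_cases hB : ∀ i j, i ≠ a.succ → corner C.1 i j = corner B.1 i j
  swap
  · refine ⟨0, isStructurePolynomial_zero fun K _ f f₁ f₂ hC hfA hfB =>
      hB fun i j hi => ?_⟩
    rw [← hC, ← hfB, ← interDim_eq_corner, ← interDim_eq_corner]
    exact interDim_congr_left ((adj_of_relPos_eq hab (hfA.trans hA)).1 i hi) j
  by_cases hp : ∃ p, IsThreshold (corner B.1 a.succ) (corner C.1 a.succ) p
  swap
  · refine ⟨0, isStructurePolynomial_zero fun K _ f f₁ f₂ hC hfA hfB => hp ?_⟩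
    obtain ⟨p, hp⟩ := exists_isThreshold (adj_of_relPos_eq hab (hfA.trans hA)).2 f₂
    refine ⟨p, ?_⟩
    simpa only [← interDim_eq_right, interDim_eq_corner, hC, hfB] using hp
  obtain ⟨p, hp⟩ := hp
  -- The codimension of `S j` (defined below) in `f₁.step a.succ`, written in terms of `C` alone so
  -- that it does not depend on the field.
  let m : Fin (n + 1) → ℕ := fun j => corner C.1 a.succ (Fin.last n) -
    (corner C.1 a.castSucc (Fin.last n) + corner C.1 a.succ j - corner C.1 a.castSucc j)
  refine ⟨qInt (m p.castSucc) - qInt (m p.succ), fun K _ _ f₁ f₂ hC => ?_⟩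
  have hC : relPos f₁ f₂ = C.1 := hC
  let S : Fin (n + 1) → Submodule K (Fin r → K) := fun j =>
    f₁.step a.castSucc ⊔ (f₁.step a.succ ⊓ f₂.step j)
  have hS : ∀ j, S j ≤ f₁.step a.succ := fun j =>
    sup_le (f₁.mono a.castSucc_lt_succ.le) inf_le_left
  have hSm : ∀ j, Module.finrank K (f₁.step a.succ) - Module.finrank K (S j) = m j := by
    intro j
    have h := finrank_step_sup f₁ f₂ a.castSucc_lt_succ.le j
    simp only [← interDim_last_right f₁ f₂, interDim_eq_corner, hC] at h ⊢
    simp only [S, m]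
    omega
  have hset : {f : Flag K n r | (f₁, f) ∈ orbit K A ∧ (f, f₂) ∈ orbit K B} =
      {f | Adj a.succ f₁ f ∧ (f₂.step p.castSucc ⊓ f₁.step a.succ ≤ f.step a.succ ∧
        ¬ f₂.step p.succ ⊓ f₁.step a.succ ≤ f.step a.succ)} := by
    ext f
    change relPos f₁ f = A.1 ∧ relPos f f₂ = B.1 ↔ _ ∧ _
    rw [hA, relPos_eq_single_add_diagonal_iff_left hab, and_assoc]
    refine and_congr_right fun hadj => ?_
    rw [← isThreshold_finrank_inf_iff hadj.2]
    simp only [← interDim_eq_right, interDim_eq_corner, hC]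
    constructor
    · rintro ⟨-, h⟩
      rwa [h]
    · intro h
      refine ⟨fun i => ?_, relPos_eq_iff.2 fun i j => ?_⟩
      · rw [← hA, ← hrow, ← hC, ← interDim_eq_corner, interDim_last_right]
      · by_cases hi : i = a.succ
        · rw [hi, interDim_eq_corner]
          exact h.eq_left hp j
        · rw [← hB i j hi, ← hC, ← interDim_eq_corner]
          exact (interDim_congr_left (hadj.1 i hi) j).symm
  rw [hset, ncard_adj_right hab f₁ fun W => f₂.step p.castSucc ⊓ f₁.step a.succ ≤ W ∧
        ¬ f₂.step p.succ ⊓ f₁.step a.succ ≤ W]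
  have hdiff : {W | (f₁.step a.castSucc ≤ W ∧ W ⋖ f₁.step a.succ) ∧
      f₂.step p.castSucc ⊓ f₁.step a.succ ≤ W ∧ ¬ f₂.step p.succ ⊓ f₁.step a.succ ≤ W} =
      {W | S p.castSucc ≤ W ∧ W ⋖ f₁.step a.succ} \ {W | S p.succ ≤ W ∧ W ⋖ f₁.step a.succ} := by
    ext W
    simp only [S, Set.mem_sdiff, Set.mem_ofPred_eq, sup_le_iff, inf_comm (f₁.step a.succ)]
    tauto
  rw [hdiff]
  refine natCast_sub_eq_eval (fun W hW => ⟨le_trans ?_ hW.1, hW.2⟩) (card_le_covBy (hS _))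
    (card_le_covBy (hS _)) (hSm _) (hSm _)
  exact sup_le_sup_left (inf_le_inf_left _ (f₂.mono p.castSucc_lt_succ.le)) _

/-- Dual to the left case: now `f` is given by a subspace covering `f₂.step a.succ` inside `f₂.step
b.succ`. By `not_inf_le_iff_of_covBy` the threshold condition says that it lies in `S p.succ` but
not in `S p.castSucc`. -/
theorem exists_isStructurePolynomial_right {a b : Fin n} (hab : (b : ℕ) = a + 1) {B : Theta n r}
    {d : Fin n → ℕ} (hB : B.1 = Matrix.single a b 1 + Matrix.diagonal d) (A C : Theta n r) :
    ∃ p, IsStructurePolynomial A B C p := by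
  have hab' : a.succ = b.castSucc := by simp [Fin.ext_iff, hab]
  have hlt : a.succ ≤ b.succ := by rw [hab']; exact b.castSucc_lt_succ.le
  by_cases hcol : ∀ i, corner C.1 (Fin.last n) i = corner B.1 (Fin.last n) i
  swap
  · refine ⟨0, isStructurePolynomial_zero fun K _ f f₁ f₂ hC hfA hfB => hcol fun i => ?_⟩
    rw [← hC, ← hfB, ← interDim_eq_corner, ← interDim_eq_corner, interDim_last_left,
      interDim_last_left]
  by_cases hA : ∀ i j, j ≠ a.succ → corner C.1 i j = corner A.1 i j
  swap
  · refine ⟨0, isStructurePolynomial_zero fun K _ f f₁ f₂ hC hfA hfB =>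
      hA fun i j hj => ?_⟩
    rw [← hC, ← hfA, ← interDim_eq_corner, ← interDim_eq_corner, interDim_comm, interDim_comm f₁]
    exact interDim_congr_left ((adj_of_relPos_eq hab (hfB.trans hB)).1 j hj).symm i
  by_cases hp : ∃ p, IsThreshold (fun i => corner C.1 i a.succ) (fun i => corner A.1 i a.succ) p
  swap
  · refine ⟨0, isStructurePolynomial_zero fun K _ f f₁ f₂ hC hfA hfB => hp ?_⟩
    obtain ⟨p, hp⟩ := exists_isThreshold (adj_of_relPos_eq hab (hfB.trans hB)).2 f₁
    refine ⟨p, ?_⟩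
    simpa only [finrank_step_inf, interDim_eq_corner, hC, hfA] using hp
  obtain ⟨p, hp⟩ := hp
  let m : Fin (n + 1) → ℕ := fun i =>
    corner C.1 (Fin.last n) a.succ + corner C.1 i b.succ - corner C.1 i a.succ -
      corner C.1 (Fin.last n) a.succ
  refine ⟨qInt (m p.succ) - qInt (m p.castSucc), fun K _ _ f₁ f₂ hC => ?_⟩
  have hC : relPos f₁ f₂ = C.1 := hC
  let S : Fin (n + 1) → Submodule K (Fin r → K) := fun i =>
    f₂.step a.succ ⊔ (f₂.step b.succ ⊓ f₁.step i)
  have hS : ∀ i, f₂.step a.succ ≤ S i := fun i => le_sup_left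
  have hSm : ∀ i, Module.finrank K (S i) - Module.finrank K (f₂.step a.succ) = m i := by
    intro i
    have h := finrank_step_sup f₂ f₁ hlt i
    simp only [← interDim_last_left f₁ f₂, interDim_comm f₂ f₁, interDim_eq_corner, hC] at h ⊢
    simp only [S, m]
    omega
  have hset : {f : Flag K n r | (f₁, f) ∈ orbit K A ∧ (f, f₂) ∈ orbit K B} =
      {f | Adj a.succ f f₂ ∧ (f₁.step p.castSucc ⊓ f.step a.succ ≤ f₂.step a.succ ∧
        ¬ f₁.step p.succ ⊓ f.step a.succ ≤ f₂.step a.succ)} := by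
    ext f
    change relPos f₁ f = A.1 ∧ relPos f f₂ = B.1 ↔ _ ∧ _
    rw [and_comm, hB, relPos_eq_single_add_diagonal_iff_right hab, and_assoc]
    refine and_congr_right fun hadj => ?_
    rw [← isThreshold_finrank_inf_iff hadj.2]
    simp only [finrank_step_inf, interDim_eq_corner, hC]
    constructor
    · rintro ⟨-, h⟩
      rwa [h]
    · intro h
      refine ⟨fun i => ?_, relPos_eq_iff.2 fun i j => ?_⟩
      · rw [← hB, ← hcol, ← hC, ← interDim_eq_corner, interDim_last_left]
      · by_cases hj : j = a.succ
        · rw [hj, interDim_eq_corner]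
          exact h.eq_right hp i
        · rw [← hA i j hj, ← hC, ← interDim_eq_corner, interDim_comm, interDim_comm f₁]
          exact interDim_congr_left (hadj.1 j hj) i
  rw [hset, ncard_adj_left hab f₂ fun W => f₁.step p.castSucc ⊓ W ≤ f₂.step a.succ ∧
        ¬ f₁.step p.succ ⊓ W ≤ f₂.step a.succ]
  have hdiff : {W | (f₂.step a.succ ⋖ W ∧ W ≤ f₂.step b.succ) ∧
      f₁.step p.castSucc ⊓ W ≤ f₂.step a.succ ∧ ¬ f₁.step p.succ ⊓ W ≤ f₂.step a.succ} =
      {W | f₂.step a.succ ⋖ W ∧ W ≤ S p.succ} \ {W | f₂.step a.succ ⋖ W ∧ W ≤ S p.castSucc} := by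
    ext W
    have hSb : ∀ i, S i ≤ f₂.step b.succ := fun i => sup_le (f₂.mono hlt) inf_le_left
    have key : f₂.step a.succ ⋖ W → W ≤ f₂.step b.succ → ∀ i,
        (¬ f₁.step i ⊓ W ≤ f₂.step a.succ ↔ W ≤ S i) := by
      intro h1 h2 i
      rw [not_inf_le_iff_of_covBy h1 h2, inf_comm (f₁.step i)]
    constructor
    · rintro ⟨⟨h1, h2⟩, h3, h4⟩
      exact ⟨⟨h1, (key h1 h2 _).1 h4⟩, fun h5 => (key h1 h2 _).2 h5.2 h3⟩
    · rintro ⟨⟨h1, h2⟩, h3⟩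
      have h4 := h2.trans (hSb _)
      refine ⟨⟨h1, h4⟩, ?_, (key h1 h4 _).2 h2⟩
      by_contra h5
      exact h3 ⟨h1, (key h1 h4 _).1 h5⟩
  rw [hdiff]
  refine natCast_sub_eq_eval (fun W hW => ⟨hW.1, le_trans hW.2 ?_⟩) (card_covBy_le (hS _))
    (card_covBy_le (hS _)) (hSm _) (hSm _)
  exact sup_le_sup_left (inf_le_inf_left _ (f₁.mono p.castSucc_lt_succ.le)) _

end Existence


/-! ### Evaluation at `q = |K|` and the convolution representation -/

section Evaluation

variable {n r : ℕ}

/-- The coefficient at `e_C`. -/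
def coeff (C : Theta n r) : QSchurAlgebra n r →ₗ[ℤ[T;T⁻¹]] ℤ[T;T⁻¹] :=
  (Finsupp.lapply C : (Theta n r →₀ ℤ[T;T⁻¹]) →ₗ[ℤ[T;T⁻¹]] ℤ[T;T⁻¹])

open Classical in
theorem coeff_e (A C : Theta n r) : coeff C (e A) = if C = A then 1 else 0 := by
  change (Finsupp.single A 1 : Theta n r →₀ ℤ[T;T⁻¹]) C = _
  rw [Finsupp.single_apply]
  exact if_congr eq_comm rfl rfl

theorem ext_coeff {x : QSchurAlgebra n r} (h : ∀ C, coeff C x = 0) : x = 0 :=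
  Finsupp.ext (f := (x : Theta n r →₀ ℤ[T;T⁻¹])) (g := 0) h

theorem induction_smul_e {P : QSchurAlgebra n r → Prop} (x : QSchurAlgebra n r) (zero : P 0)
    (add : ∀ x y, P x → P y → P (x + y)) (smul : ∀ (c : ℤ[T;T⁻¹]) A, P (c • e A)) : P x := by
  refine Finsupp.induction_linear (motive := P) (x : Theta n r →₀ ℤ[T;T⁻¹]) zero
    (fun x y => add x y) fun A c => ?_
  have := smul c A
  rwa [show c • e A = (Finsupp.single A c : Theta n r →₀ ℤ[T;T⁻¹]) from by
    refine (Finsupp.smul_single c A (1 : ℤ[T;T⁻¹])).trans ?_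
    rw [smul_eq_mul, mul_one]] at this

theorem mul_smul_comm' (c : ℤ[T;T⁻¹]) (x y : QSchurAlgebra n r) : x * (c • y) = c • (x * y) :=
  (mulBilin n r x).map_smul c y

theorem smul_mul_assoc' (c : ℤ[T;T⁻¹]) (x y : QSchurAlgebra n r) : (c • x) * y = c • (x * y) :=
  LinearMap.map_smul₂ (mulBilin n r) c x y

variable (K : Type) [Field K] [Finite K]

/-- Evaluation of Laurent polynomials at the number of elements of a finite field. -/
def evalCard : ℤ[T;T⁻¹] →+* ℚ :=
  LaurentPolynomial.eval₂ (Int.castRingHom ℚ)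
    (Units.mk0 (Nat.card K : ℚ) (Nat.cast_ne_zero.2 Nat.card_pos.ne'))

theorem evalCard_toLaurent (p : ℤ[X]) :
    evalCard K p.toLaurent = ((p.eval (Nat.card K : ℤ) : ℤ) : ℚ) := by
  rw [evalCard, LaurentPolynomial.eval₂_toLaurent, Units.val_mk0,
    show (Nat.card K : ℚ) = Int.castRingHom ℚ (Nat.card K : ℤ) by simp, Polynomial.eval₂_at_apply]
  rfl

theorem evalCard_q : evalCard K q = Nat.card K := by
  rw [q, ← Polynomial.toLaurent_X, evalCard_toLaurent, Polynomial.eval_X, Int.cast_natCast]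

/-- After multiplication by a power of `q`, `c` is a polynomial with every prime as a root. -/
theorem eq_zero_of_evalCard (c : ℤ[T;T⁻¹])
    (h : ∀ (p : ℕ) [Fact p.Prime], evalCard (ZMod p) c = 0) : c = 0 := by
  obtain ⟨m, f, hf⟩ := c.exists_T_pow
  have hf0 : f = 0 := by
    refine Polynomial.eq_zero_of_infinite_isRoot f ?_
    refine Set.Infinite.mono ?_ (Nat.infinite_setOfPred_prime.image
      (f := fun p : ℕ => (p : ℤ)) (Nat.cast_injective.injOn))
    rintro _ ⟨p, hp, rfl⟩
    have : Fact p.Prime := ⟨hp⟩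
    have h1 := evalCard_toLaurent (ZMod p) f
    rw [hf, map_mul, h p, zero_mul, Nat.card_zmod] at h1
    exact Int.cast_eq_zero.1 h1.symm
  rw [hf0, map_zero] at hf
  exact ((LaurentPolynomial.isUnit_T (R := ℤ) (m : ℤ)).mul_left_eq_zero).1 hf.symm

instance : Fintype (Flag K n r) := Fintype.ofFinite _

/-- The function on pairs of flags that is given by an element of the `q`-Schur algebra, as a
matrix: multiplication is convolution of functions. -/
def rep : QSchurAlgebra n r →+ Matrix (Flag K n r) (Flag K n r) ℚ where
  toFun x := Matrix.of fun f g => evalCard K (coeff (position f g) x)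
  map_zero' := by ext; simp
  map_add' x y := by ext; simp

theorem rep_apply (x : QSchurAlgebra n r) (f g : Flag K n r) :
    rep K x f g = evalCard K (coeff (position f g) x) := rfl

open Classical in
theorem rep_e (A : Theta n r) (f g : Flag K n r) :
    rep K (e A) f g = if position f g = A then 1 else 0 := by
  rw [rep_apply, coeff_e]
  split_ifs <;> simp

theorem rep_smul (c : ℤ[T;T⁻¹]) (x : QSchurAlgebra n r) :
    rep K (c • x) = evalCard K c • rep K x := by
  ext f g
  simp [rep_apply]

theorem eq_of_rep_eq {x y : QSchurAlgebra n r}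
    (h : ∀ (p : ℕ) [Fact p.Prime], rep (ZMod p) x = rep (ZMod p) y) : x = y := by
  rw [← sub_eq_zero]
  refine ext_coeff fun C => eq_zero_of_evalCard _ fun p _ => ?_
  obtain ⟨f, g, hfg⟩ := exists_position_eq (ZMod p) C
  rw [← hfg, ← rep_apply, map_sub, h p, sub_self, Matrix.zero_apply]

/-- The hypothesis excludes the default value 0 of `structurePolynomial`, so that the coefficients
really count the intermediate flags in the matrix product. -/
theorem rep_e_mul_e {A B : Theta n r} (h : ∀ C, ∃ p, IsStructurePolynomial A B C p) :
    rep K (e A * e B) = rep K (e A) * rep K (e B) := by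
  classical
  ext f g
  have h1 : coeff (position f g) (e A * e B) =
      (structurePolynomial A B (position f g)).toLaurent := by
    rw [e_mul_e, map_sum, Finset.sum_eq_single (position f g)]
    · rw [map_smul, coeff_e, if_pos rfl, smul_eq_mul, mul_one]
    · intro C _ hC
      rw [map_smul, coeff_e, if_neg hC.symm, smul_zero]
    · simp
  have h2 : IsStructurePolynomial A B (position f g)
      (structurePolynomial A B (position f g)) := by
    rw [structurePolynomial, dif_pos (h _)]
    exact (h _).choose_spec
  rw [rep_apply, h1, evalCard_toLaurent, ← h2 K f g rfl, Matrix.mul_apply]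
  simp_rw [rep_e, mem_orbit_iff, ite_zero_mul_ite_zero, mul_one]
  rw [Finset.sum_boole, Set.ncard_eq_toFinset_card', Set.toFinset_ofPred, Int.cast_natCast]

theorem rep_e_mul {A : Theta n r} (h : ∀ B C, ∃ p, IsStructurePolynomial A B C p)
    (x : QSchurAlgebra n r) : rep K (e A * x) = rep K (e A) * rep K x := by
  induction x using induction_smul_e with
  | zero => simp
  | add x y hx hy => simp [mul_add, hx, hy]
  | smul c B => rw [mul_smul_comm', rep_smul, rep_smul, rep_e_mul_e K (h B), mul_smul_comm]

theorem rep_mul_e {B : Theta n r} (h : ∀ A C, ∃ p, IsStructurePolynomial A B C p)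
    (x : QSchurAlgebra n r) : rep K (x * e B) = rep K x * rep K (e B) := by
  induction x using induction_smul_e with
  | zero => simp
  | add x y hx hy => simp [add_mul, hx, hy]
  | smul c A => rw [smul_mul_assoc', rep_smul, rep_smul, rep_e_mul_e K (h A), smul_mul_assoc]

/-- The position of the step in which `E n r i` changes a flag. -/
def stepIndex (i : Fin (n - 1)) : Fin (n + 1) := (⟨i, by omega⟩ : Fin n).succ

theorem rep_E_mul (i : Fin (n - 1)) (x : QSchurAlgebra n r) :
    rep K (E n r i * x) = rep K (E n r i) * rep K x := by
  classical
  rw [E, l, Finset.sum_mul, map_sum, map_sum, Finset.sum_mul]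
  refine Finset.sum_congr rfl fun A hA => ?_
  obtain ⟨d, hd⟩ := (Finset.mem_filter.1 hA).2
  exact rep_e_mul K (exists_isStructurePolynomial_left rfl hd) x

theorem rep_mul_E (i : Fin (n - 1)) (x : QSchurAlgebra n r) :
    rep K (x * E n r i) = rep K x * rep K (E n r i) := by
  classical
  rw [E, l, Finset.mul_sum, map_sum, map_sum, Finset.mul_sum]
  refine Finset.sum_congr rfl fun A hA => ?_
  obtain ⟨d, hd⟩ := (Finset.mem_filter.1 hA).2
  exact rep_mul_e K (exists_isStructurePolynomial_right rfl hd) x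

open Classical in
/-- The matrix of the relation `Adj h`. -/
def adjMatrix (h : Fin (n + 1)) : Matrix (Flag K n r) (Flag K n r) ℚ :=
  Matrix.of fun f g => if Adj h f g then 1 else 0

theorem rep_E (i : Fin (n - 1)) : rep K (E n r i) = adjMatrix K (stepIndex i) := by
  classical
  ext f g
  rw [E, l, map_sum, Matrix.sum_apply]
  simp_rw [rep_e]
  rw [Finset.sum_ite_eq, adjMatrix, Matrix.of_apply]
  refine if_congr ?_ rfl rfl
  exact (Finset.mem_filter.trans (and_iff_right (Finset.mem_univ _))).trans
    (adj_iff (a := (⟨i, by omega⟩ : Fin n)) (b := ⟨i + 1, by omega⟩) rfl).symm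

end Evaluation


/-! ### Subspaces strictly between two of codimension two -/

section MiddleSubspaces

variable {K V : Type*} [Field K] [Finite K] [AddCommGroup V] [Module K V] [FiniteDimensional K V]

theorem ncard_covBy_covBy {G F W : Submodule K V} (h1 : G ⋖ W) (h2 : W ⋖ F) :
    {W | G ⋖ W ∧ W ⋖ F}.ncard = Nat.card K + 1 := by
  have hF := (covBy_iff_finrank.1 h2).2
  rw [(covBy_iff_finrank.1 h1).2] at hF
  have hset : {W | G ⋖ W ∧ W ⋖ F} = {W | G ⋖ W ∧ W ≤ F} := by
    ext U
    refine and_congr_right fun hU => ⟨fun h => h.le, fun h => covBy_iff_finrank.2 ⟨h, ?_⟩⟩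
    rw [hF, (covBy_iff_finrank.1 hU).2]
  rw [hset, card_covBy_le (h1.le.trans h2.le), hF, show Module.finrank K G + 1 + 1 -
    Module.finrank K G = 2 by omega, Finset.sum_range_succ, Finset.sum_range_one, pow_zero, pow_one,
    add_comm]

/-- If any `W` exists, then `F ⊓ G'` is a hyperplane of `F` containing `G`, hence the only `W`
inside `G'`. Otherwise both sides are zero. -/
theorem ncard_covBy_covBy_le {G F G' F' : Submodule K V} (hG : G ≤ G') (hF : F ≤ F')
    (h : G' ⋖ F') (hFG : ¬ F ≤ G') :
    {W | G ⋖ W ∧ W ⋖ F}.ncard =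
      (Nat.card K + 1) * {W | (G ⋖ W ∧ W ⋖ F) ∧ W ≤ G'}.ncard := by
  by_cases hne : ∃ W, G ⋖ W ∧ W ⋖ F
  · obtain ⟨W, h1, h2⟩ := hne
    have hGF := h1.le.trans h2.le
    have hFd : Module.finrank K F = Module.finrank K G + 1 + 1 := by
      rw [(covBy_iff_finrank.1 h2).2, (covBy_iff_finrank.1 h1).2]
    have hinf : Module.finrank K F = Module.finrank K ↥(F ⊓ G') + 1 := by
      have := finrank_inf_of_covBy h F
      rwa [inf_eq_left.2 hF, if_neg hFG] at this
    have hset : {W | (G ⋖ W ∧ W ⋖ F) ∧ W ≤ G'} = {F ⊓ G'} := by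
      ext U
      constructor
      · rintro ⟨⟨h3, h4⟩, h5⟩
        refine Submodule.eq_of_le_of_finrank_eq (le_inf h4.le h5) ?_
        have := (covBy_iff_finrank.1 h4).2
        omega
      · rintro rfl
        exact ⟨⟨covBy_iff_finrank.2 ⟨le_inf hGF hG, by omega⟩,
          covBy_iff_finrank.2 ⟨inf_le_left, hinf⟩⟩, inf_le_right⟩
    rw [hset, Set.ncard_singleton, mul_one, ncard_covBy_covBy h1 h2]
  · have h0 : {W | G ⋖ W ∧ W ⋖ F} = ∅ :=
      Set.eq_empty_of_forall_notMem fun W hW => hne ⟨W, hW⟩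
    have h1 : {W | (G ⋖ W ∧ W ⋖ F) ∧ W ≤ G'} = ∅ :=
      Set.eq_empty_of_forall_notMem fun W hW => hne ⟨W, hW.1⟩
    rw [h0, h1, Set.ncard_empty, mul_zero]

/-- Dually, `G ⊓ F' = G'`, so `G ⊔ F'` has dimension one more than `G` and is the only `W`
containing `F'`. -/
theorem ncard_covBy_covBy_ge {G F G' F' : Submodule K V} (hG : G' ≤ G) (hF : F' ≤ F)
    (h : G' ⋖ F') (hFG : ¬ F' ≤ G) :
    {W | G ⋖ W ∧ W ⋖ F}.ncard =
      (Nat.card K + 1) * {W | (G ⋖ W ∧ W ⋖ F) ∧ F' ≤ W}.ncard := by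
  by_cases hne : ∃ W, G ⋖ W ∧ W ⋖ F
  · obtain ⟨W, h1, h2⟩ := hne
    have hGF := h1.le.trans h2.le
    have hFd : Module.finrank K F = Module.finrank K G + 1 + 1 := by
      rw [(covBy_iff_finrank.1 h2).2, (covBy_iff_finrank.1 h1).2]
    have hsup : Module.finrank K ↥(G ⊔ F') = Module.finrank K G + 1 := by
      have h3 := Submodule.finrank_sup_add_finrank_inf_eq G F'
      have h4 : G ⊓ F' = G' := by
        rcases h.eq_or_eq (le_inf hG h.le) inf_le_right with h' | h'
        · exact h'
        · exact absurd (inf_eq_right.1 h') hFG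
      have h5 := (covBy_iff_finrank.1 h).2
      rw [h4] at h3
      omega
    have hset : {W | (G ⋖ W ∧ W ⋖ F) ∧ F' ≤ W} = {G ⊔ F'} := by
      ext U
      constructor
      · rintro ⟨⟨h3, h4⟩, h5⟩
        refine (Submodule.eq_of_le_of_finrank_eq (sup_le h3.le h5) ?_).symm
        have := (covBy_iff_finrank.1 h3).2
        omega
      · rintro rfl
        exact ⟨⟨covBy_iff_finrank.2 ⟨le_sup_left, hsup⟩,
          covBy_iff_finrank.2 ⟨sup_le hGF hF, by omega⟩⟩, le_sup_right⟩
    rw [hset, Set.ncard_singleton, mul_one, ncard_covBy_covBy h1 h2]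
  · have h0 : {W | G ⋖ W ∧ W ⋖ F} = ∅ :=
      Set.eq_empty_of_forall_notMem fun W hW => hne ⟨W, hW⟩
    have h1 : {W | (G ⋖ W ∧ W ⋖ F) ∧ F' ≤ W} = ∅ :=
      Set.eq_empty_of_forall_notMem fun W hW => hne ⟨W, hW.1⟩
    rw [h0, h1, Set.ncard_empty, mul_zero]

end MiddleSubspaces

/-! ### Counting paths of adjacent flags -/

section Paths

variable {K : Type} [Field K] {n r : ℕ} {s t : Fin (n + 1)} {f g : Flag K n r}

theorem Flag.exists_replace_upper (hs0 : 0 < s) (hsl : s < Fin.last n)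
    (hfg : ∀ k, k ≠ s → k ≠ t → f.step k = g.step k) {W : Submodule K (Fin r → K)}
    (hgW : g.step s ≤ W) (hWf : W ≤ f.step s) (hW : t < s → f.step t ≤ W) :
    ∃ p : Flag K n r, p.step s = W ∧ ∀ k, k ≠ s → p.step k = f.step k := by
  refine ⟨f.replace s W hs0 hsl (fun k hk => ?_) fun k hk => hWf.trans (f.mono hk.le),
    f.replace_step_self .., fun k hk => Function.update_of_ne hk _ _⟩
  by_cases hkt : k = t
  · subst hkt
    exact hW hk
  · rw [hfg k hk.ne hkt]
    exact (g.mono hk.le).trans hgW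

theorem Flag.exists_replace_lower (hs0 : 0 < s) (hsl : s < Fin.last n)
    (hfg : ∀ k, k ≠ s → k ≠ t → f.step k = g.step k) {W : Submodule K (Fin r → K)}
    (hgW : g.step s ≤ W) (hWf : W ≤ f.step s) (hW : s < t → W ≤ g.step t) :
    ∃ p : Flag K n r, p.step s = W ∧ ∀ k, k ≠ s → p.step k = g.step k := by
  refine ⟨g.replace s W hs0 hsl (fun k hk => (g.mono hk.le).trans hgW) (fun k hk => ?_),
    g.replace_step_self .., fun k hk => Function.update_of_ne hk _ _⟩
  by_cases hkt : k = t
  · subst hkt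
    exact hW hk
  · rw [← hfg k hk.ne' hkt]
    exact hWf.trans (f.mono hk.le)

theorem adj_of_step {h : Fin (n + 1)} (hne : ∀ k, k ≠ h → f.step k = g.step k)
    {U W : Submodule K (Fin r → K)} (hf : f.step h = U) (hg : g.step h = W) (hc : W ⋖ U) :
    Adj h f g :=
  ⟨hne, by rwa [hf, hg]⟩

/-- Off the steps `s` and `t` the flags agree, and in step `t` the flag `g` is a hyperplane
of `f`. -/
def AgreeOff (s t : Fin (n + 1)) (f g : Flag K n r) : Prop :=
  (∀ k, k ≠ s → k ≠ t → f.step k = g.step k) ∧ g.step t ⋖ f.step t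

/-- In this and the next two lemmas both intermediate flags are determined by one subspace `W` in
step `s`, and the extra conditions say exactly that they are monotone. Here their steps `(s, t)` are
`(W, f_t)` and `(g_s, f_t)`. -/
theorem ncard_adj_self_self_other (hst : s ≠ t) (hs0 : 0 < s) (hsl : s < Fin.last n) (ht0 : 0 < t)
    (htl : t < Fin.last n) (h : AgreeOff s t f g) :
    {p : Flag K n r × Flag K n r | Adj s f p.1 ∧ Adj s p.1 p.2 ∧ Adj t p.2 g}.ncard =
      {W | (g.step s ⋖ W ∧ W ⋖ f.step s) ∧ (t < s → f.step t ≤ g.step s)}.ncard := by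
  have hinj : Set.InjOn (fun p : Flag K n r × Flag K n r => p.1.step s)
      {p | Adj s f p.1 ∧ Adj s p.1 p.2 ∧ Adj t p.2 g} := by
    rintro ⟨p, p'⟩ ⟨h1, h2, h3⟩ ⟨u, u'⟩ ⟨k1, k2, k3⟩ hpu
    dsimp only at h1 h2 h3 k1 k2 k3 hpu
    have e1 : p = u := Flag.ext_step fun k => by
      by_cases hk : k = s
      · rw [hk, hpu]
      · rw [← h1.1 k hk, k1.1 k hk]
    have e2 : p' = u' := Flag.ext_step fun k => by
      by_cases hk : k = s
      · rw [hk, h3.1 s hst, k3.1 s hst]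
      · rw [← h2.1 k hk, ← k2.1 k hk, e1]
    rw [e1, e2]
  rw [← hinj.ncard_image]
  congr 1
  ext W
  constructor
  · rintro ⟨⟨p, p'⟩, ⟨h1, h2, h3⟩, rfl⟩
    dsimp only at h1 h2 h3 ⊢
    refine ⟨⟨h3.1 s hst ▸ h2.2, h1.2⟩, fun hts => ?_⟩
    rw [h1.1 t hst.symm, h2.1 t hst.symm, ← h3.1 s hst]
    exact p'.mono hts.le
  · rintro ⟨⟨h1, h2⟩, h3⟩
    obtain ⟨p, hps, hp⟩ := Flag.exists_replace_upper hs0 hsl h.1 h1.le h2.le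
      fun hts => (h3 hts).trans h1.le
    obtain ⟨p', hps', hp'⟩ := Flag.exists_replace_lower ht0 htl (t := s)
      (fun k h1 h2 => h.1 k h2 h1) h.2.le le_rfl h3
    refine ⟨⟨p, p'⟩, ⟨⟨fun k hk => (hp k hk).symm, hps ▸ h2⟩, ?_, hp', hps' ▸ h.2⟩, hps⟩
    refine adj_of_step (fun k hk => ?_) hps (hp' s hst) h1
    rw [hp k hk]
    by_cases hkt : k = t
    · rw [hkt, hps']
    · rw [hp' k hkt, h.1 k hk hkt]

theorem ncard_adj_self_other_self (hst : s ≠ t) (hs0 : 0 < s) (hsl : s < Fin.last n)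
    (h : AgreeOff s t f g) :
    {p : Flag K n r × Flag K n r | Adj s f p.1 ∧ Adj t p.1 p.2 ∧ Adj s p.2 g}.ncard =
      {W | (g.step s ⋖ W ∧ W ⋖ f.step s) ∧
        (t < s → f.step t ≤ W) ∧ (s < t → W ≤ g.step t)}.ncard := by
  have hinj : Set.InjOn (fun p : Flag K n r × Flag K n r => p.1.step s)
      {p | Adj s f p.1 ∧ Adj t p.1 p.2 ∧ Adj s p.2 g} := by
    rintro ⟨p, p'⟩ ⟨h1, h2, h3⟩ ⟨u, u'⟩ ⟨k1, k2, k3⟩ hpu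
    dsimp only at h1 h2 h3 k1 k2 k3 hpu
    have e1 : p = u := Flag.ext_step fun k => by
      by_cases hk : k = s
      · rw [hk, hpu]
      · rw [← h1.1 k hk, k1.1 k hk]
    have e2 : p' = u' := Flag.ext_step fun k => by
      by_cases hk : k = s
      · rw [hk, ← h2.1 s hst, ← k2.1 s hst, e1]
      · rw [h3.1 k hk, k3.1 k hk]
    rw [e1, e2]
  rw [← hinj.ncard_image]
  congr 1
  ext W
  constructor
  · rintro ⟨⟨p, p'⟩, ⟨h1, h2, h3⟩, rfl⟩
    dsimp only at h1 h2 h3 ⊢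
    refine ⟨⟨h2.1 s hst ▸ h3.2, h1.2⟩, fun hts => ?_, fun hts => ?_⟩
    · rw [h1.1 t hst.symm]
      exact p.mono hts.le
    · rw [h2.1 s hst, ← h3.1 t hst.symm]
      exact p'.mono hts.le
  · rintro ⟨⟨h1, h2⟩, h3, h4⟩
    obtain ⟨p, hps, hp⟩ := Flag.exists_replace_upper hs0 hsl h.1 h1.le h2.le h3
    obtain ⟨p', hps', hp'⟩ := Flag.exists_replace_lower hs0 hsl h.1 h1.le h2.le h4
    refine ⟨⟨p, p'⟩, ⟨⟨fun k hk => (hp k hk).symm, hps ▸ h2⟩, ?_, hp', hps' ▸ h1⟩, hps⟩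
    refine adj_of_step (fun k hk => ?_) (hp t hst.symm) (hp' t hst.symm) h.2
    by_cases hks : k = s
    · rw [hks, hps, hps']
    · rw [hp k hks, hp' k hks, h.1 k hks hk]

theorem ncard_adj_other_self_self (hst : s ≠ t) (hs0 : 0 < s) (hsl : s < Fin.last n) (ht0 : 0 < t)
    (htl : t < Fin.last n) (h : AgreeOff s t f g) :
    {p : Flag K n r × Flag K n r | Adj t f p.1 ∧ Adj s p.1 p.2 ∧ Adj s p.2 g}.ncard =
      {W | (g.step s ⋖ W ∧ W ⋖ f.step s) ∧ (s < t → f.step s ≤ g.step t)}.ncard := by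
  have hinj : Set.InjOn (fun p : Flag K n r × Flag K n r => p.2.step s)
      {p | Adj t f p.1 ∧ Adj s p.1 p.2 ∧ Adj s p.2 g} := by
    rintro ⟨p, p'⟩ ⟨h1, h2, h3⟩ ⟨u, u'⟩ ⟨k1, k2, k3⟩ hpu
    dsimp only at h1 h2 h3 k1 k2 k3 hpu
    have e2 : p' = u' := Flag.ext_step fun k => by
      by_cases hk : k = s
      · rw [hk, hpu]
      · rw [h3.1 k hk, k3.1 k hk]
    have e1 : p = u := Flag.ext_step fun k => by
      by_cases hk : k = s
      · rw [hk, ← h1.1 s hst, ← k1.1 s hst]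
      · rw [h2.1 k hk, k2.1 k hk, e2]
    rw [e1, e2]
  rw [← hinj.ncard_image]
  congr 1
  ext W
  constructor
  · rintro ⟨⟨p, p'⟩, ⟨h1, h2, h3⟩, rfl⟩
    dsimp only at h1 h2 h3 ⊢
    refine ⟨⟨h3.2, (h1.1 s hst) ▸ h2.2⟩, fun hts => ?_⟩
    rw [h1.1 s hst, ← h3.1 t hst.symm, ← h2.1 t hst.symm]
    exact p.mono hts.le
  · rintro ⟨⟨h1, h2⟩, h3⟩
    obtain ⟨p, hps, hp⟩ := Flag.exists_replace_upper ht0 htl (t := s)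
      (fun k h1 h2 => h.1 k h2 h1) le_rfl h.2.le h3
    obtain ⟨p', hps', hp'⟩ := Flag.exists_replace_lower hs0 hsl h.1 h1.le h2.le
      fun hts => h2.le.trans (h3 hts)
    refine ⟨⟨p, p'⟩, ⟨⟨fun k hk => (hp k hk).symm, hps ▸ h.2⟩, ?_, hp', hps' ▸ h1⟩, hps'⟩
    refine adj_of_step (fun k hk => ?_) (hp s hst) hps' h2
    rw [hp' k hk]
    by_cases hkt : k = t
    · rw [hkt, hps]
    · rw [hp k hkt, h.1 k hk hkt]

theorem AgreeOff.of_self_self_other (hst : s ≠ t) {p p' : Flag K n r} (h1 : Adj s f p)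
    (h2 : Adj s p p') (h3 : Adj t p' g) : AgreeOff s t f g :=
  ⟨fun k hs ht => by rw [h1.1 k hs, h2.1 k hs, h3.1 k ht],
    by rw [h1.1 t hst.symm, h2.1 t hst.symm]; exact h3.2⟩

theorem AgreeOff.of_self_other_self (hst : s ≠ t) {p p' : Flag K n r} (h1 : Adj s f p)
    (h2 : Adj t p p') (h3 : Adj s p' g) : AgreeOff s t f g :=
  ⟨fun k hs ht => by rw [h1.1 k hs, h2.1 k ht, h3.1 k hs],
    by rw [h1.1 t hst.symm, ← h3.1 t hst.symm]; exact h2.2⟩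

theorem AgreeOff.of_other_self_self (hst : s ≠ t) {p p' : Flag K n r} (h1 : Adj t f p)
    (h2 : Adj s p p') (h3 : Adj s p' g) : AgreeOff s t f g :=
  ⟨fun k hs ht => by rw [h1.1 k ht, h2.1 k hs, h3.1 k hs],
    by rw [← h3.1 t hst.symm, ← h2.1 t hst.symm]; exact h1.2⟩

theorem ncard_eq_zero_of_forall {α : Type*} {P : α → Prop} (h : ∀ p, ¬ P p) :
    {p | P p}.ncard = 0 := by
  rw [Set.eq_empty_of_forall_notMem (s := {p | P p}) h, Set.ncard_empty]

/-- Replacing step `t` of `f` first could fail only if `s < t` and `f_s` is not inside `g_t`. A step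
`k` in between, common to both flags, prevents this: `f_s ≤ f_k = g_k ≤ g_t`. -/
theorem exists_adj_adj_swap (ht0 : 0 < t) (htl : t < Fin.last n)
    (hst : s < t → ∃ k, s < k ∧ k < t) (hne : s ≠ t)
    {p : Flag K n r} (h1 : Adj s f p) (h2 : Adj t p g) : ∃ p', Adj t f p' ∧ Adj s p' g := by
  have hfg : ∀ k, k ≠ t → k ≠ s → f.step k = g.step k := fun k hkt hks => by
    rw [h1.1 k hks, h2.1 k hkt]
  have hle : g.step t ≤ f.step t := h1.1 t hne.symm ▸ h2.2.le
  obtain ⟨p', hpt, hp'⟩ := Flag.exists_replace_upper ht0 htl hfg le_rfl hle fun h => by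
    obtain ⟨k, hk1, hk2⟩ := hst h
    exact (f.mono hk1.le).trans ((hfg k hk2.ne hk1.ne').le.trans (g.mono hk2.le))
  refine ⟨p', ⟨fun k hk => (hp' k hk).symm, ?_⟩, fun k hk => ?_, ?_⟩
  · rw [hpt, h1.1 t hne.symm]
    exact h2.2
  · by_cases hkt : k = t
    · rw [hkt, hpt]
    · rw [hp' k hkt, hfg k hkt hk]
  · rw [hp' s hne, ← h2.1 s hne]
    exact h1.2

theorem adj_adj_unique (hne : s ≠ t) {p p' : Flag K n r} (h1 : Adj s f p) (h2 : Adj t p g)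
    (h1' : Adj s f p') (h2' : Adj t p' g) : p = p' := by
  refine Flag.ext_step fun k => ?_
  by_cases hk : k = s
  · rw [hk, h2.1 s hne, h2'.1 s hne]
  · rw [← h1.1 k hk, h1'.1 k hk]

variable [Finite K]

theorem serre_count_of_lt (hst : s < t) (hs0 : 0 < s) (hsl : s < Fin.last n) (ht0 : 0 < t)
    (htl : t < Fin.last n) (f g : Flag K n r) :
    {p : Flag K n r × Flag K n r | Adj s f p.1 ∧ Adj s p.1 p.2 ∧ Adj t p.2 g}.ncard +
      Nat.card K *
        {p : Flag K n r × Flag K n r | Adj t f p.1 ∧ Adj s p.1 p.2 ∧ Adj s p.2 g}.ncard =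
      (Nat.card K + 1) *
        {p : Flag K n r × Flag K n r | Adj s f p.1 ∧ Adj t p.1 p.2 ∧ Adj s p.2 g}.ncard := by
  by_cases h : AgreeOff s t f g
  · rw [ncard_adj_self_self_other hst.ne hs0 hsl ht0 htl h,
      ncard_adj_self_other_self hst.ne hs0 hsl h,
      ncard_adj_other_self_self hst.ne hs0 hsl ht0 htl h]
    simp only [hst, hst.not_gt, false_imp_iff, true_imp_iff, and_true, true_and]
    -- If `f_s ≤ g_t`, all three counts coincide. If not, no path changes step `t` first, and
    -- `ncard_covBy_covBy_le` compares the other two.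
    by_cases hle : f.step s ≤ g.step t
    · have : {W | (g.step s ⋖ W ∧ W ⋖ f.step s) ∧ W ≤ g.step t} =
          {W | g.step s ⋖ W ∧ W ⋖ f.step s} := by
        ext W
        exact and_iff_left_of_imp fun hW => hW.2.le.trans hle
      simp only [this, hle, and_true]
      ring
    · rw [ncard_eq_zero_of_forall (P := fun W => (g.step s ⋖ W ∧ W ⋖ f.step s) ∧ f.step s ≤ _)
        fun W hW => hle hW.2, mul_zero, add_zero]
      exact ncard_covBy_covBy_le (g.mono hst.le) (f.mono hst.le) h.2 hle
  · rw [ncard_eq_zero_of_forall fun p hp => h (.of_self_self_other hst.ne hp.1 hp.2.1 hp.2.2),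
      ncard_eq_zero_of_forall fun p hp => h (.of_other_self_self hst.ne hp.1 hp.2.1 hp.2.2),
      ncard_eq_zero_of_forall fun p hp => h (.of_self_other_self hst.ne hp.1 hp.2.1 hp.2.2),
      mul_zero, mul_zero, add_zero]

theorem serre_count_of_gt (hst : t < s) (hs0 : 0 < s) (hsl : s < Fin.last n) (ht0 : 0 < t)
    (htl : t < Fin.last n) (f g : Flag K n r) :
    {p : Flag K n r × Flag K n r | Adj t f p.1 ∧ Adj s p.1 p.2 ∧ Adj s p.2 g}.ncard +
      Nat.card K *
        {p : Flag K n r × Flag K n r | Adj s f p.1 ∧ Adj s p.1 p.2 ∧ Adj t p.2 g}.ncard =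
      (Nat.card K + 1) *
        {p : Flag K n r × Flag K n r | Adj s f p.1 ∧ Adj t p.1 p.2 ∧ Adj s p.2 g}.ncard := by
  by_cases h : AgreeOff s t f g
  · rw [ncard_adj_self_self_other hst.ne' hs0 hsl ht0 htl h,
      ncard_adj_self_other_self hst.ne' hs0 hsl h,
      ncard_adj_other_self_self hst.ne' hs0 hsl ht0 htl h]
    simp only [hst, hst.not_gt, false_imp_iff, true_imp_iff, and_true]
    by_cases hle : f.step t ≤ g.step s
    · have : {W | (g.step s ⋖ W ∧ W ⋖ f.step s) ∧ f.step t ≤ W} =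
          {W | g.step s ⋖ W ∧ W ⋖ f.step s} := by
        ext W
        exact and_iff_left_of_imp fun hW => hle.trans hW.1.le
      simp only [this, hle, and_true]
      ring
    · rw [ncard_eq_zero_of_forall (P := fun W => (g.step s ⋖ W ∧ W ⋖ f.step s) ∧ _ ≤ g.step s)
        fun W hW => hle hW.2, mul_zero, add_zero]
      exact ncard_covBy_covBy_ge (g.mono hst.le) (f.mono hst.le) h.2 hle
  · rw [ncard_eq_zero_of_forall fun p hp => h (.of_other_self_self hst.ne' hp.1 hp.2.1 hp.2.2),
      ncard_eq_zero_of_forall fun p hp => h (.of_self_self_other hst.ne' hp.1 hp.2.1 hp.2.2),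
      ncard_eq_zero_of_forall fun p hp => h (.of_self_other_self hst.ne' hp.1 hp.2.1 hp.2.2),
      mul_zero, mul_zero, add_zero]

theorem ncard_adj_adj_le (hne : s ≠ t) (ht0 : 0 < t) (htl : t < Fin.last n)
    (hst : s < t → ∃ k, s < k ∧ k < t) (f g : Flag K n r) :
    {p : Flag K n r | Adj s f p ∧ Adj t p g}.ncard ≤
      {p : Flag K n r | Adj t f p ∧ Adj s p g}.ncard := by
  by_cases h : ∃ p : Flag K n r, Adj s f p ∧ Adj t p g
  · obtain ⟨p, h1, h2⟩ := h
    obtain ⟨p', hp'⟩ := exists_adj_adj_swap ht0 htl hst hne h1 h2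
    refine le_trans ((Set.ncard_le_one (Set.toFinite _)).2 ?_)
      ((Set.ncard_pos (Set.toFinite _)).2 ⟨p', hp'⟩)
    rintro u ⟨hu1, hu2⟩ v ⟨hv1, hv2⟩
    exact adj_adj_unique hne hu1 hu2 hv1 hv2
  · rw [ncard_eq_zero_of_forall fun p hp => h ⟨p, hp⟩]
    exact Nat.zero_le _

end Paths

/-! ### The relations between adjacency matrices -/

section Relations

variable {K : Type} [Field K] [Finite K] {n r : ℕ} {s t : Fin (n + 1)}

theorem adjMatrix_mul_apply (s t : Fin (n + 1)) (f g : Flag K n r) :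
    (adjMatrix K s * adjMatrix K t : Matrix (Flag K n r) (Flag K n r) ℚ) f g =
      {p : Flag K n r | Adj s f p ∧ Adj t p g}.ncard := by
  classical
  rw [Matrix.mul_apply]
  simp_rw [adjMatrix, Matrix.of_apply, ite_zero_mul_ite_zero, mul_one]
  rw [Finset.sum_boole, Set.ncard_eq_toFinset_card', Set.toFinset_ofPred]

theorem adjMatrix_mul_mul_apply (s t u : Fin (n + 1)) (f g : Flag K n r) :
    (adjMatrix K s * (adjMatrix K t * adjMatrix K u) : Matrix (Flag K n r) (Flag K n r) ℚ) f g =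
      {p : Flag K n r × Flag K n r | Adj s f p.1 ∧ Adj t p.1 p.2 ∧ Adj u p.2 g}.ncard := by
  classical
  simp_rw [Matrix.mul_apply, Finset.mul_sum]
  simp_rw [adjMatrix, Matrix.of_apply, ite_zero_mul_ite_zero, mul_one]
  rw [← Fintype.sum_prod_type', Finset.sum_boole, Set.ncard_eq_toFinset_card', Set.toFinset_ofPred]

theorem adjMatrix_serre_of_lt (hs0 : 0 < s) (hsl : s < Fin.last n) (ht0 : 0 < t)
    (htl : t < Fin.last n) (hst : s < t) :
    (adjMatrix K s * (adjMatrix K s * adjMatrix K t) : Matrix (Flag K n r) (Flag K n r) ℚ) -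
      ((Nat.card K : ℚ) + 1) • (adjMatrix K s * (adjMatrix K t * adjMatrix K s)) +
      (Nat.card K : ℚ) • (adjMatrix K t * (adjMatrix K s * adjMatrix K s)) = 0 := by
  ext f g
  simp only [Matrix.add_apply, Matrix.sub_apply, Matrix.smul_apply, adjMatrix_mul_mul_apply,
    smul_eq_mul, Matrix.zero_apply]
  have := congrArg (Nat.cast : ℕ → ℚ) (serre_count_of_lt hst hs0 hsl ht0 htl f g)
  push_cast at this
  linear_combination this

theorem adjMatrix_serre_of_gt (hs0 : 0 < s) (hsl : s < Fin.last n) (ht0 : 0 < t)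
    (htl : t < Fin.last n) (hst : t < s) :
    (adjMatrix K t * (adjMatrix K s * adjMatrix K s) : Matrix (Flag K n r) (Flag K n r) ℚ) -
      ((Nat.card K : ℚ) + 1) • (adjMatrix K s * (adjMatrix K t * adjMatrix K s)) +
      (Nat.card K : ℚ) • (adjMatrix K s * (adjMatrix K s * adjMatrix K t)) = 0 := by
  ext f g
  simp only [Matrix.add_apply, Matrix.sub_apply, Matrix.smul_apply, adjMatrix_mul_mul_apply,
    smul_eq_mul, Matrix.zero_apply]
  have := congrArg (Nat.cast : ℕ → ℚ) (serre_count_of_gt hst hs0 hsl ht0 htl f g)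
  push_cast at this
  linear_combination this

theorem adjMatrix_comm (hs0 : 0 < s) (hsl : s < Fin.last n) (ht0 : 0 < t)
    (htl : t < Fin.last n) (hne : s ≠ t) (hst : s < t → ∃ k, s < k ∧ k < t)
    (hts : t < s → ∃ k, t < k ∧ k < s) :
    (adjMatrix K s * adjMatrix K t : Matrix (Flag K n r) (Flag K n r) ℚ) =
      adjMatrix K t * adjMatrix K s := by
  ext f g
  rw [adjMatrix_mul_apply, adjMatrix_mul_apply, le_antisymm
    (ncard_adj_adj_le hne ht0 htl hst f g) (ncard_adj_adj_le hne.symm hs0 hsl hts f g)]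

theorem stepIndex_pos (i : Fin (n - 1)) : 0 < stepIndex i := Fin.succ_pos _

theorem stepIndex_lt_last (i : Fin (n - 1)) : stepIndex i < Fin.last n := by
  simp only [stepIndex, Fin.lt_def, Fin.val_succ, Fin.val_last]
  omega

theorem stepIndex_lt_iff {i j : Fin (n - 1)} : stepIndex i < stepIndex j ↔ (i : ℕ) < j := by
  simp [stepIndex]

theorem exists_between_stepIndex {i j : Fin (n - 1)} (h : 1 < |(i : ℤ) - (j : ℤ)|)
    (hij : stepIndex i < stepIndex j) : ∃ k, stepIndex i < k ∧ k < stepIndex j := by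
  rw [stepIndex_lt_iff] at hij
  rw [lt_abs] at h
  refine ⟨⟨i + 2, by omega⟩, ?_, ?_⟩ <;> simp only [stepIndex, Fin.lt_def, Fin.val_succ] <;> omega

end Relations

end QSchur

end

open QSchur in
theorem mainTheorem8 (n r : ℕ) :
    (∀ i j : Fin (n - 1), (j : ℕ) = (i : ℕ) + 1 →
      (QSchur.E n r i * QSchur.E n r i) * QSchur.E n r j
          - (QSchur.q + 1) • ((QSchur.E n r i * QSchur.E n r j) * QSchur.E n r i)
          + QSchur.q • (QSchur.E n r j * (QSchur.E n r i * QSchur.E n r i)) = 0) ∧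
    (∀ i j : Fin (n - 1), (i : ℕ) = (j : ℕ) + 1 →
      QSchur.E n r j * (QSchur.E n r i * QSchur.E n r i)
          - (QSchur.q + 1) • ((QSchur.E n r i * QSchur.E n r j) * QSchur.E n r i)
          + QSchur.q • ((QSchur.E n r i * QSchur.E n r i) * QSchur.E n r j) = 0) ∧
    (∀ i j : Fin (n - 1), 1 < |(i : ℤ) - (j : ℤ)| →
      QSchur.E n r i * QSchur.E n r j - QSchur.E n r j * QSchur.E n r i = 0) ∧
    (∀ i j k : Fin (n - 1),
      (QSchur.E n r i * QSchur.E n r j) * QSchur.E n r k =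
        QSchur.E n r i * (QSchur.E n r j * QSchur.E n r k)) := by
  refine ⟨fun i j hij => ?_, fun i j hij => ?_, fun i j hij => ?_, fun i j k => ?_⟩ <;>
    -- All four claims are checked over the prime fields `ZMod p`.
    refine eq_of_rep_eq fun p _ => ?_
  · simp only [map_add, map_sub, map_zero, map_one, rep_smul, rep_mul_E, rep_E_mul, rep_E,
      evalCard_q, mul_assoc]
    exact adjMatrix_serre_of_lt (K := ZMod p) (stepIndex_pos i) (stepIndex_lt_last i)
      (stepIndex_pos j) (stepIndex_lt_last j) (stepIndex_lt_iff.2 (by omega))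
  · simp only [map_add, map_sub, map_zero, map_one, rep_smul, rep_mul_E, rep_E_mul, rep_E,
      evalCard_q, mul_assoc]
    exact adjMatrix_serre_of_gt (K := ZMod p) (stepIndex_pos i) (stepIndex_lt_last i)
      (stepIndex_pos j) (stepIndex_lt_last j) (stepIndex_lt_iff.2 (by omega))
  · simp only [map_sub, map_zero, rep_mul_E, rep_E]
    rw [sub_eq_zero]
    refine adjMatrix_comm (K := ZMod p) (stepIndex_pos i) (stepIndex_lt_last i) (stepIndex_pos j)
      (stepIndex_lt_last j) (fun h => ?_) (exists_between_stepIndex hij)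
      (exists_between_stepIndex (abs_sub_comm (i : ℤ) j ▸ hij))
    have : (i : ℕ) = j := by simpa [stepIndex] using h
    simp [this] at hij
  · simp only [rep_mul_E, rep_E_mul, mul_assoc]
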